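/- Let $n>0$. Let $Sp(n)$ be the group of quaternionic $n\times n$ matrices $A$ with $A^*A=AA^*=I$, acting on the unit sphere $S^{4n-1}\subset\mathbb{H}^n$ by $A\cdot x=Ax$; this action is transitive, with the stabilizer of a coordinate vector equal to $Sp(n-1)$, so that $S^{4n-1}=Sp(n)/Sp(n-1)$. Let $Sp(n)Sp(1)$ be the group of diffeomorphisms $x\mapsto A\,x\,\bar q$ of $S^{4n-1}$ with $A\in Sp(n)$ and $q$ a unit quaternion. A Finsler metric on $M=S^{4n-1}$ is a continuous function $F:TM\to[0,\infty)$, positive and smooth off the zero section, with $F(x,\lambda y)=\lambda F(x,y)$ for all $\lambda\ge 0$, and such that for every $x$ and every $y\ne 0$ in $T_xM$ the Hessian of $\tfrac12F(x,\cdot)^2$ at $y$ is positive definite. It is called an $Sp(n)$-geodesic orbit metric if every geodesic of positive constant speed is an orbit of a one-parameter subgroup of $Sp(n)$, i.e. for every geodesic $c:J\to M$ of positive constant speed on an open interval $J$ there are a skew-Hermitian quaternionic $n\times n$ matrix $X$ (an element of the Lie algebra of $Sp(n)$) and a point $p\in M$ with $c(t)=\exp(tX)\cdot p$ for all $t\in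 J$. **Corollary.** If an $Sp(n)$-invariant (i.e. homogeneous) Finsler metric $F$ on $M=Sp(n)/Sp(n-1)=S^{4n-1}$ is an $Sp(n)$-geodesic orbit metric, then $F$ is $Sp(n)Sp(1)$-invariant. -/

import Mathlib

open scoped Quaternion Manifold ContDiff

noncomputable section

namespace GeodesicOrbit

/-! ### Finsler metrics and their geodesics on a smooth manifold of dimension `d` -/

/-- A Finsler metric on a smooth `d`-dimensional manifold `M`: a continuous function
`F : TM → [0, ∞)`, positive and smooth off the zero section, positively homogeneous of degree one
on every tangent space, such that for every `y ≠ 0` in `T_x M` the Hessian of `F² / 2` on the vector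
space `T_x M` at `y` is positive definite.  The value `g_y(u, u)` of this Hessian is written as the
second derivative of `t ↦ F(x, y + t u)² / 2` at `t = 0`. -/
structure FinslerMetric (d : ℕ) (M : Type*) [TopologicalSpace M]
    [ChartedSpace (EuclideanSpace ℝ (Fin d)) M] [IsManifold (𝓡 d) ∞ M] where
  toFun : TangentBundle (𝓡 d) M → ℝ
  continuous_toFun : Continuous toFun
  smooth_off_zero : ContMDiffOn (𝓡 d).tangent 𝓘(ℝ, ℝ) ∞ toFun {v | v.2 ≠ 0}
  pos_off_zero : ∀ (x : M) (y : TangentSpace (𝓡 d) x), y ≠ 0 → 0 < toFun ⟨x, y⟩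
  homogeneous : ∀ (x : M) (y : TangentSpace (𝓡 d) x) (a : ℝ), 0 ≤ a →
    toFun ⟨x, a • y⟩ = a * toFun ⟨x, y⟩
  hessian_pos : ∀ (x : M) (y u : TangentSpace (𝓡 d) x), y ≠ 0 → u ≠ 0 →
    0 < iteratedDeriv 2 (fun t : ℝ => toFun ⟨x, y + t • u⟩ ^ 2 / 2) 0

/-- The velocity `c'(t)`, as a point of the tangent bundle. -/
def velocity {d : ℕ} {M : Type*} [TopologicalSpace M]
    [ChartedSpace (EuclideanSpace ℝ (Fin d)) M] (c : ℝ → M) (t : ℝ) : TangentBundle (𝓡 d) M :=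
  ⟨c t, mfderiv 𝓘(ℝ, ℝ) (𝓡 d) c t (1 : ℝ)⟩

namespace FinslerMetric

variable {d : ℕ} {M : Type*} [TopologicalSpace M] [ChartedSpace (EuclideanSpace ℝ (Fin d)) M]
  [IsManifold (𝓡 d) ∞ M]

/-- The energy `½ ∫ₐᵇ F(c'(t))² dt` of a curve. -/
def energy (F : FinslerMetric d M) (a b : ℝ) (c : ℝ → M) : ℝ :=
  ∫ t in a..b, F.toFun (velocity c t) ^ 2 / 2

/-- `h s t` is a smooth variation (`|s| < ε`) of the curve `c` on the open interval `J` that fixes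
the points at the times `a` and `b`. -/
structure IsVariation (d : ℕ) {M : Type*} [TopologicalSpace M]
    [ChartedSpace (EuclideanSpace ℝ (Fin d)) M] (c : ℝ → M) (J : Set ℝ) (a b ε : ℝ) (h : ℝ → ℝ → M) : Prop where
  smooth : ContMDiffOn 𝓘(ℝ, ℝ × ℝ) (𝓡 d) ∞ (fun p : ℝ × ℝ => h p.1 p.2)
    (Set.Ioo (-ε) ε ×ˢ J)
  base : ∀ t ∈ J, h 0 t = c t
  left : ∀ s ∈ Set.Ioo (-ε) ε, h s a = c a
  right : ∀ s ∈ Set.Ioo (-ε) ε, h s b = c b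

/-- A geodesic of positive constant speed, on the open interval `J`: a smooth curve on `J` with
`F(c'(t))` a positive constant, which on every compact subinterval `[a, b]` of `J` is a critical
point of the energy under variations with fixed end points. -/
structure IsGeodesicOn (F : FinslerMetric d M) (c : ℝ → M) (J : Set ℝ) : Prop where
  smooth : ContMDiffOn 𝓘(ℝ, ℝ) (𝓡 d) ∞ c J
  speed : ∃ k : ℝ, 0 < k ∧ ∀ t ∈ J, F.toFun (velocity c t) = k
  critical : ∀ a b : ℝ, a < b → Set.Icc a b ⊆ J → ∀ ε : ℝ, 0 < ε → ∀ h : ℝ → ℝ → M,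
    IsVariation d c J a b ε h → HasDerivAt (fun s => F.energy a b (h s)) 0 0

/-- `F` is invariant under the action of `G` on `M`. -/
def IsInvariant (F : FinslerMetric d M) (G : Type*) [SMul G M] : Prop :=
  ∀ (g : G) (x : M) (y : TangentSpace (𝓡 d) x),
    F.toFun ⟨g • x, mfderiv (𝓡 d) (𝓡 d) (fun z : M => g • z) x y⟩ = F.toFun ⟨x, y⟩

end FinslerMetric

/-! ### The homogeneous space `Sp(n)/Sp(n-1)` -/

/-- The compact symplectic group: the quaternionic `n × n` matrices `A` with `A* A = A A* = 1`. -/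
abbrev Sp (n : ℕ) : Type := unitary (Matrix (Fin n) (Fin n) ℍ[ℝ])

/-- `Sp(1)` as the group of unit quaternions. -/
abbrev UnitQuaternion : Type := unitary ℍ[ℝ]

/-- The Lie algebra of `Sp(n)`: the quaternionic `n × n` matrices `X` with `X* = -X`. -/
abbrev LieSp (n : ℕ) : Type := skewAdjoint (Matrix (Fin n) (Fin n) ℍ[ℝ])

/-- The space `ℍⁿ` of quaternionic column vectors, with its Euclidean norm. -/
abbrev HSpace (n : ℕ) : Type := EuclideanSpace ℍ[ℝ] (Fin n)

theorem finrank_hSpace (n : ℕ) : Module.finrank ℝ (HSpace n) = 4 * n := by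
  rw [LinearEquiv.finrank_eq (WithLp.linearEquiv 2 ℝ (Fin n → ℍ[ℝ])), Module.finrank_pi_fintype]
  simp [Quaternion.finrank_eq_four, mul_comm]

instance (n : ℕ) [NeZero n] : Fact (Module.finrank ℝ (HSpace n) = (4 * n - 1) + 1) :=
  ⟨by rw [finrank_hSpace]; have := NeZero.pos n; omega⟩

/-- The unit sphere `S^{4n-1}` of `ℍⁿ`, with its standard smooth structure.  The group `Sp(n)` acts
transitively on it by `(A, x) ↦ A x`, and the stabilizer of a coordinate vector is `Sp(n-1)`: this
is the homogeneous space `Sp(n)/Sp(n-1)`. -/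
abbrev HSphere (n : ℕ) : Type := Metric.sphere (0 : HSpace n) 1

theorem normSq_mulVec (n : ℕ) (A : Sp n) (v : Fin n → ℍ[ℝ]) :
    ∑ i, ‖(A.1.mulVec v) i‖ ^ 2 = ∑ i, ‖v i‖ ^ 2 := by
  have key : ∀ w : Fin n → ℍ[ℝ], ((∑ i, ‖w i‖ ^ 2 : ℝ) : ℍ[ℝ]) = star w ⬝ᵥ w := by
    intro w
    rw [dotProduct]
    refine (map_sum (algebraMap ℝ ℍ[ℝ]) (fun i => ‖w i‖ ^ 2) Finset.univ).trans ?_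
    refine Finset.sum_congr rfl fun i _ => ?_
    rw [Pi.star_apply, Quaternion.star_mul_self, Quaternion.normSq_eq_norm_mul_self, sq]
    rfl
  apply Quaternion.coe_injective (R := ℝ)
  have hA : Matrix.conjTranspose A.1 * A.1 = 1 := (Unitary.mem_iff.1 A.2).1
  rw [key, key, Matrix.star_mulVec, ← Matrix.dotProduct_mulVec, Matrix.mulVec_mulVec, hA,
    Matrix.one_mulVec]

theorem norm_unitQuaternion (q : UnitQuaternion) : ‖star (q : ℍ[ℝ])‖ = 1 := by
  have h : star (q : ℍ[ℝ]) * q = 1 := (Unitary.mem_iff.1 q.2).1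
  have h2 := congrArg norm h
  rw [norm_mul, norm_star, norm_one] at h2
  rw [norm_star]
  nlinarith [norm_nonneg (q : ℍ[ℝ])]

theorem mem_sphere_act (n : ℕ) (A : Sp n) (q : UnitQuaternion) (x : HSphere n) :
    WithLp.toLp 2 (fun i => (A.1.mulVec x.1.ofLp) i * star (q : ℍ[ℝ])) ∈
      Metric.sphere (0 : HSpace n) 1 := by
  have hx : ‖x.1‖ = 1 := by simpa using x.2
  rw [mem_sphere_zero_iff_norm, PiLp.norm_eq_of_L2]
  rw [PiLp.norm_eq_of_L2] at hx
  simp only [norm_mul, norm_unitQuaternion, mul_one]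
  rw [normSq_mulVec n A x.1.ofLp]
  exact hx

/-- The action of `Sp(n) × Sp(1)` on `S^{4n-1}` by `(A, q) · x = A x q̄`.  Its image in the
diffeomorphism group is `Sp(n)Sp(1)`. -/
instance smulProd (n : ℕ) : SMul (Sp n × UnitQuaternion) (HSphere n) where
  smul g x := ⟨WithLp.toLp 2 (fun i => (g.1.1.mulVec x.1.ofLp) i * star (g.2 : ℍ[ℝ])),
    mem_sphere_act n g.1 g.2 x⟩

instance mulActionProd (n : ℕ) : MulAction (Sp n × UnitQuaternion) (HSphere n) where
  one_smul x := by
    apply Subtype.ext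
    change WithLp.toLp 2 (fun i =>
      ((1 : Matrix (Fin n) (Fin n) ℍ[ℝ]).mulVec x.1.ofLp) i * star (1 : ℍ[ℝ])) = x.1
    simp
  mul_smul g k x := by
    apply Subtype.ext
    change WithLp.toLp 2 (fun i => ((g.1.1 * k.1.1).mulVec x.1.ofLp) i *
        star ((g.2 : ℍ[ℝ]) * (k.2 : ℍ[ℝ]))) =
      WithLp.toLp 2 (fun i => (g.1.1.mulVec (fun j => (k.1.1.mulVec x.1.ofLp) j *
        star (k.2 : ℍ[ℝ]))) i * star (g.2 : ℍ[ℝ]))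
    congr 1
    funext i
    rw [← Matrix.mulVec_mulVec, star_mul]
    simp only [Matrix.mulVec, dotProduct, ← mul_assoc, ← Finset.sum_mul]

/-- The action of `Sp(n)` on `S^{4n-1}` by `A · x = A x`. -/
instance smulSp (n : ℕ) : SMul (Sp n) (HSphere n) where
  smul A x := ⟨WithLp.toLp 2 (A.1.mulVec x.1.ofLp), by
    have h := mem_sphere_act n A 1 x
    simp only [OneMemClass.coe_one, star_one, mul_one] at h
    exact h⟩

instance mulActionSp (n : ℕ) : MulAction (Sp n) (HSphere n) where
  one_smul x := by
    apply Subtype.ext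
    change WithLp.toLp 2 ((1 : Matrix (Fin n) (Fin n) ℍ[ℝ]).mulVec x.1.ofLp) = x.1
    simp
  mul_smul A B x := by
    apply Subtype.ext
    change WithLp.toLp 2 ((A.1 * B.1).mulVec x.1.ofLp) =
      WithLp.toLp 2 (A.1.mulVec (B.1.mulVec x.1.ofLp))
    rw [Matrix.mulVec_mulVec]

theorem exp_mem_unitary (n : ℕ) (X : LieSp n) (t : ℝ) :
    NormedSpace.exp (t • X.1) ∈ unitary (Matrix (Fin n) (Fin n) ℍ[ℝ]) := by
  let _ : NormedAlgebra ℚ ℍ[ℝ] := NormedAlgebra.restrictScalars ℚ ℝ _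
  have hX : star X.1 = -X.1 := skewAdjoint.mem_iff.1 X.2
  have ht : star (t • X.1) = -(t • X.1) := by
    rw [← smul_neg, ← hX]
    ext1 i j
    exact Quaternion.star_smul t (X.1 j i)
  have hs : star (NormedSpace.exp (t • X.1)) = NormedSpace.exp (-(t • X.1)) := by
    rw [Matrix.star_eq_conjTranspose, ← Matrix.exp_conjTranspose, ← Matrix.star_eq_conjTranspose, ht]
  rw [Unitary.mem_iff, hs, ← Matrix.exp_add_of_commute _ _ (Commute.refl (t • X.1)).neg_left,
    ← Matrix.exp_add_of_commute _ _ (Commute.refl (t • X.1)).neg_right]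
  simp

/-- The one-parameter subgroup `t ↦ exp(t X)` of `Sp(n)` generated by `X` in its Lie algebra. -/
def oneParam {n : ℕ} (X : LieSp n) (t : ℝ) : Sp n :=
  ⟨NormedSpace.exp (t • X.1), exp_mem_unitary n X t⟩

/-- `F` is an `Sp(n)`-geodesic orbit metric on `S^{4n-1} = Sp(n)/Sp(n-1)`: every geodesic of
positive constant speed is an orbit `t ↦ exp(t X) · p` of the one-parameter subgroup generated by
some `X` in the Lie algebra of `Sp(n)`. -/
def IsSpGeodesicOrbit {n : ℕ} [NeZero n] (F : FinslerMetric (4 * n - 1) (HSphere n)) : Prop :=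
  ∀ (J : Set ℝ) (c : ℝ → HSphere n), IsOpen J → J.OrdConnected → F.IsGeodesicOn c J →
    ∃ (X : LieSp n) (p : HSphere n), ∀ t ∈ J, c t = oneParam X t • p

end GeodesicOrbit

end

noncomputable section

namespace GeodesicOrbit

/-! ### Lagrangian mechanics on a finite-dimensional vector space -/

section Lagrangian

open Set Filter Topology MeasureTheory ContinuousLinearMap

variable {V : Type*} [NormedAddCommGroup V] [NormedSpace ℝ V]

/-! The mechanism is Noether's theorem read backwards. Right multiplication by a quaternion `θ`
commutes with `Sp(n)`. Along a geodesic `exp(tX)·x`, invariance under `Sp(n)` therefore makes the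
momentum paired with the field `v ↦ vθ` constant. By the Euler-Lagrange equation, the derivative of
this pairing is the infinitesimal change of the Lagrangian under `v ↦ vθ`, which must then vanish. A
geodesic starts in every direction, so this holds at every tangent vector
(`IsSpGeodesicOrbit.force_add_momentum_rightMul`). Integrating along the circles `cos s + θ sin s`,
which cover the unit quaternions, gives invariance under `Sp(1)`.

To avoid charts, `F² / 2` is pulled back to the ambient space by radial projection and `(⟪v, w⟫ /
‖v‖²)² / 2` is added (`sphereLagrangian`). The extra term restores positivity in the radial
direction, so the Euler-Lagrange equation becomes a smooth ODE (`exists_isEulerLagrangeOn`). The sum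
is invariant under scaling, so solutions that start tangent to the sphere stay on it and are
geodesics of `F` (`IsEulerLagrangeOn.isGeodesicOn`). -/

/-- The derivative of a Lagrangian in the velocity. -/
def momentum (L : V × V → ℝ) (z : V × V) : V →L[ℝ] ℝ := (fderiv ℝ L z).comp (inr ℝ V V)

/-- The derivative of a Lagrangian in the position. -/
def force (L : V × V → ℝ) (z : V × V) : V →L[ℝ] ℝ := (fderiv ℝ L z).comp (inl ℝ V V)

theorem fderiv_eq_force_add_momentum (L : V × V → ℝ) (z : V × V) (a b : V) :
    fderiv ℝ L z (a, b) = force L z a + momentum L z b := by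
  simp only [force, momentum, comp_apply, inl_apply, inr_apply]
  rw [← map_add]; simp

variable {L : V × V → ℝ} {Ω : Set (V × V)}

theorem contDiffOn_fderiv_lagrangian (hΩ : IsOpen Ω) (hL : ContDiffOn ℝ ∞ L Ω) :
    ContDiffOn ℝ ∞ (fderiv ℝ L) Ω :=
  hL.fderiv_of_isOpen hΩ (by simp)

theorem contDiffOn_momentum (hΩ : IsOpen Ω) (hL : ContDiffOn ℝ ∞ L Ω) :
    ContDiffOn ℝ ∞ (momentum L) Ω :=
  (contDiffOn_fderiv_lagrangian hΩ hL).clm_comp contDiffOn_const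

theorem contDiffOn_force (hΩ : IsOpen Ω) (hL : ContDiffOn ℝ ∞ L Ω) :
    ContDiffOn ℝ ∞ (force L) Ω :=
  (contDiffOn_fderiv_lagrangian hΩ hL).clm_comp contDiffOn_const

theorem hasFDerivAt_lagrangian (hΩ : IsOpen Ω) (hL : ContDiffOn ℝ ∞ L Ω) {z : V × V} (hz : z ∈ Ω) :
    HasFDerivAt L (fderiv ℝ L z) z :=
  ((hL.contDiffAt (hΩ.mem_nhds hz)).differentiableAt (by simp)).hasFDerivAt

theorem hasDerivAt_lagrangian (hΩ : IsOpen Ω) (hL : ContDiffOn ℝ ∞ L Ω) {x y : ℝ → V} {x' y' : V}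
    {t : ℝ} (hz : (x t, y t) ∈ Ω) (hx : HasDerivAt x x' t) (hy : HasDerivAt y y' t) :
    HasDerivAt (fun s => L (x s, y s))
      (force L (x t, y t) x' + momentum L (x t, y t) y') t := by
  rw [← fderiv_eq_force_add_momentum]
  exact (hasFDerivAt_lagrangian hΩ hL hz).comp_hasDerivAt t (hx.prodMk hy)

/-- The Hessian of the Lagrangian in the velocity. -/
def velocityHessian (L : V × V → ℝ) (z : V × V) : V →L[ℝ] V →L[ℝ] ℝ :=
  (fderiv ℝ (momentum L) z).comp (inr ℝ V V)

theorem velocityHessian_apply_self (hΩ : IsOpen Ω) (hL : ContDiffOn ℝ ∞ L Ω) {x y : V}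
    (hz : (x, y) ∈ Ω) (u : V) :
    velocityHessian L (x, y) u u = iteratedDeriv 2 (fun t : ℝ => L (x, y + t • u)) 0 := by
  have hline : ∀ t : ℝ, HasDerivAt (fun t : ℝ => y + t • u) u t := fun t => by
    simpa using ((hasDerivAt_id t).smul_const u).const_add y
  have hcont : Continuous fun t : ℝ => (x, y + t • u) := by fun_prop
  have hline0 : y + (0 : ℝ) • u = y := by rw [zero_smul, add_zero]
  have hmem : ∀ᶠ t : ℝ in 𝓝 0, (x, y + t • u) ∈ Ω :=
    hcont.continuousAt.eventually_mem (hΩ.mem_nhds (by rwa [hline0]))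
  have h1 : deriv (fun t : ℝ => L (x, y + t • u)) =ᶠ[𝓝 0]
      fun t => momentum L (x, y + t • u) u := by
    filter_upwards [hmem] with t ht
    have h := (hasDerivAt_lagrangian hΩ hL (x := fun _ => x) ht (hasDerivAt_const t x)
      (hline t)).deriv
    rwa [map_zero, zero_add] at h
  have hM : HasFDerivAt (momentum L) (fderiv ℝ (momentum L) (x, y)) (x, y + (0 : ℝ) • u) := by
    rw [hline0]
    exact (((contDiffOn_momentum hΩ hL).contDiffAt (hΩ.mem_nhds hz)).differentiableAt
      (by simp)).hasFDerivAt
  have h2 := hM.comp_hasDerivAt 0 ((hasDerivAt_const 0 x).prodMk (hline 0))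
  have h3 := ((ContinuousLinearMap.apply ℝ ℝ u).hasFDerivAt.comp_hasDerivAt 0 h2).deriv
  rw [iteratedDeriv_succ, iteratedDeriv_one, h1.deriv_eq]
  exact h3.symm

/-- Bootstrapping: if `γ` is `C^k`, then so is its derivative `f ∘ γ`, hence `γ` is `C^(k+1)`. -/
theorem contDiffOn_of_hasDerivAt {W : Type*} [NormedAddCommGroup W] [NormedSpace ℝ W]
    {f : W → W} {U : Set W} (hf : ContDiffOn ℝ ∞ f U) {γ : ℝ → W} {J : Set ℝ} (hJ : IsOpen J)
    (hγU : MapsTo γ J U) (hγ : ∀ t ∈ J, HasDerivAt γ (f (γ t)) t) : ContDiffOn ℝ ∞ γ J := by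
  rw [contDiffOn_infty]
  intro k
  induction k with
  | zero => exact contDiffOn_zero.2 fun t ht => (hγ t ht).continuousAt.continuousWithinAt
  | succ k ih =>
    push_cast
    rw [contDiffOn_succ_iff_deriv_of_isOpen hJ]
    refine ⟨fun t ht => (hγ t ht).differentiableAt.differentiableWithinAt, by simp, ?_⟩
    exact ((hf.of_le (by exact_mod_cast le_top)).comp ih hγU).congr fun t ht => (hγ t ht).deriv

/-- A positive definite form has trivial kernel, and `V` and its dual have the same dimension. -/
theorem isInvertible_velocityHessian [FiniteDimensional ℝ V] {z : V × V}
    (hpos : ∀ u : V, u ≠ 0 → 0 < velocityHessian L z u u) :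
    (velocityHessian L z).IsInvertible := by
  have hinj : Function.Injective (velocityHessian L z : V →ₗ[ℝ] V →L[ℝ] ℝ) := by
    rw [← LinearMap.ker_eq_bot, LinearMap.ker_eq_bot']
    intro u hu
    by_contra hne
    have h := hpos u hne
    have : velocityHessian L z u = 0 := hu
    simp [this] at h
  have hdim : Module.finrank ℝ V = Module.finrank ℝ (V →L[ℝ] ℝ) := by
    rw [← (LinearMap.toContinuousLinearMap (𝕜 := ℝ) (E := V) (F' := ℝ)).finrank_eq]
    simp
  let e := (LinearEquiv.ofInjectiveOfFinrankEq _ hinj hdim).toContinuousLinearEquiv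
  exact ⟨e, by ext; rfl⟩

/-- A smooth curve in position space whose lift stays in `Ω` and which solves the Euler-Lagrange
equation on `J`. -/
structure IsEulerLagrangeOn (L : V × V → ℝ) (Ω : Set (V × V)) (v : ℝ → V) (J : Set ℝ) : Prop where
  contDiffOn : ContDiffOn ℝ ∞ v J
  mem : ∀ t ∈ J, (v t, deriv v t) ∈ Ω
  hasDerivAt_momentum : ∀ t ∈ J,
    HasDerivAt (fun τ => momentum L (v τ, deriv v τ)) (force L (v t, deriv v t)) t

/-- Invertibility of the velocity Hessian lets the equation be solved for the acceleration; the
resulting smooth first-order system on `Ω` has local solutions by Picard-Lindelöf. -/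
theorem exists_isEulerLagrangeOn [FiniteDimensional ℝ V] (hΩ : IsOpen Ω)
    (hL : ContDiffOn ℝ ∞ L Ω)
    (hpos : ∀ z ∈ Ω, ∀ u : V, u ≠ 0 →
      0 < iteratedDeriv 2 (fun t : ℝ => L (z.1, z.2 + t • u)) 0)
    {z₀ : V × V} (hz₀ : z₀ ∈ Ω) :
    ∃ ε : ℝ, 0 < ε ∧ ∃ v : ℝ → V, v 0 = z₀.1 ∧ deriv v 0 = z₀.2 ∧
      IsEulerLagrangeOn L Ω v (Ioo (-ε) ε) := by
  have hinv : ∀ z ∈ Ω, (velocityHessian L z).IsInvertible := fun z hz =>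
    isInvertible_velocityHessian fun u hu =>
      (velocityHessian_apply_self hΩ hL hz u).symm ▸ hpos z hz u hu
  have hM := contDiffOn_momentum hΩ hL
  have hM' : ContDiffOn ℝ ∞ (fderiv ℝ (momentum L)) Ω := hM.fderiv_of_isOpen hΩ (by simp)
  have hH : ContDiffOn ℝ ∞ (velocityHessian L) Ω := hM'.clm_comp contDiffOn_const
  -- Expanding the time derivative of the momentum gives `∂ₓp · v' + Hessian · v'' = force`; this is
  -- its solution for `v''`.
  let acc : V × V → V := fun z =>
    ContinuousLinearMap.inverse (velocityHessian L z)
      (force L z - fderiv ℝ (momentum L) z (z.2, 0))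
  have hacc : ContDiffOn ℝ ∞ acc Ω := by
    refine ContDiffOn.clm_apply (fun z hz => ?_) ((contDiffOn_force hΩ hL).sub
      (hM'.clm_apply (contDiffOn_snd.prodMk contDiffOn_const)))
    exact (hinv z hz).contDiffAt_map_inverse.comp_contDiffWithinAt z (hH z hz)
  let f : V × V → V × V := fun z => (z.2, acc z)
  have hf : ContDiffOn ℝ ∞ f Ω := contDiffOn_snd.prodMk hacc
  obtain ⟨α, hα0, ε₁, hε₁, hα⟩ :=
    ((hf.contDiffAt (hΩ.mem_nhds hz₀)).of_le
      (by exact_mod_cast le_top)).exists_forall_mem_closedBall_exists_eq_forall_mem_Ioo_hasDerivAt₀ 0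
  have hcont : ContinuousAt α 0 := (hα 0 (by simp [hε₁])).continuousAt
  -- The ODE solution may leave `Ω`; a shorter time interval keeps it inside.
  obtain ⟨ε₂, hε₂, hball⟩ := Metric.mem_nhds_iff.1
    (hcont.preimage_mem_nhds (hΩ.mem_nhds (hα0.symm ▸ hz₀)))
  have hε : 0 < min ε₁ ε₂ := lt_min hε₁ hε₂
  have hmem : ∀ t ∈ Ioo (-min ε₁ ε₂) (min ε₁ ε₂), α t ∈ Ω := fun t ht => by
    refine hball ?_
    rw [Metric.mem_ball, dist_zero_right, Real.norm_eq_abs, abs_lt]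
    have := min_le_right ε₁ ε₂
    constructor <;> linarith [ht.1, ht.2]
  have hder : ∀ t ∈ Ioo (-min ε₁ ε₂) (min ε₁ ε₂), HasDerivAt α (f (α t)) t := fun t ht => by
    refine hα t ?_
    have := min_le_left ε₁ ε₂
    constructor <;> linarith [ht.1, ht.2]
  have hder1 : ∀ t ∈ Ioo (-min ε₁ ε₂) (min ε₁ ε₂),
      deriv (fun t => (α t).1) t = (α t).2 := fun t ht =>
    ((hasFDerivAt_fst (𝕜 := ℝ) (p := α t)).comp_hasDerivAt t (hder t ht)).deriv
  refine ⟨min ε₁ ε₂, hε, fun t => (α t).1, by simp [hα0], ?_, ?_, fun t ht => ?_, fun t ht => ?_⟩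
  · rw [hder1 0 (by simp [hε₁, hε₂]), hα0]
  · exact contDiffOn_fst.comp (contDiffOn_of_hasDerivAt hf isOpen_Ioo hmem hder)
      (mapsTo_univ _ _) |>.mono subset_rfl
  · rw [hder1 t ht]; exact hmem t ht
  · rw [hder1 t ht]
    have hev : (fun τ => momentum L ((α τ).1, deriv (fun t => (α t).1) τ)) =ᶠ[𝓝 t]
        fun τ => momentum L (α τ) := by
      filter_upwards [isOpen_Ioo.mem_nhds ht] with τ hτ
      rw [hder1 τ hτ]
    refine HasDerivAt.congr_of_eventuallyEq ?_ hev
    have h1 : HasFDerivAt (momentum L) (fderiv ℝ (momentum L) (α t)) (α t) :=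
      ((hM.contDiffAt (hΩ.mem_nhds (hmem t ht))).differentiableAt (by simp)).hasFDerivAt
    have h2 := h1.comp_hasDerivAt t (hder t ht)
    have h3 : fderiv ℝ (momentum L) (α t) (f (α t)) = force L (α t) := by
      have hsplit : f (α t) = ((α t).2, 0) + inr ℝ V V (acc (α t)) := by simp [f]
      have hsolve : velocityHessian L (α t) (acc (α t)) =
          force L (α t) - fderiv ℝ (momentum L) (α t) ((α t).2, 0) := by
        obtain ⟨e, he⟩ := hinv _ (hmem t ht)
        simp only [acc, ← he, inverse_equiv]
        exact e.apply_symm_apply _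
      rw [hsplit, map_add]
      change _ + velocityHessian L (α t) (acc (α t)) = _
      rw [hsolve]; abel
    rw [h3] at h2
    exact h2

namespace IsEulerLagrangeOn

variable {v : ℝ → V} {J : Set ℝ}

theorem hasDerivAt (h : IsEulerLagrangeOn L Ω v J) (hJ : IsOpen J) {t : ℝ} (ht : t ∈ J) :
    HasDerivAt v (deriv v t) t :=
  ((h.contDiffOn.contDiffAt (hJ.mem_nhds ht)).differentiableAt (by simp)).hasDerivAt

theorem contDiffOn_deriv (h : IsEulerLagrangeOn L Ω v J) (hJ : IsOpen J) :
    ContDiffOn ℝ ∞ (deriv v) J := ((contDiffOn_infty_iff_deriv_of_isOpen hJ).1 h.contDiffOn).2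

theorem hasDerivAt_deriv (h : IsEulerLagrangeOn L Ω v J) (hJ : IsOpen J) {t : ℝ} (ht : t ∈ J) :
    HasDerivAt (deriv v) (deriv (deriv v) t) t :=
  (((h.contDiffOn_deriv hJ).contDiffAt (hJ.mem_nhds ht)).differentiableAt (by simp)).hasDerivAt

theorem hasDerivAt_momentum_apply (h : IsEulerLagrangeOn L Ω v J) {t : ℝ}
    (ht : t ∈ J) {ξ : ℝ → V} {ξ' : V} (hξ : HasDerivAt ξ ξ' t) :
    HasDerivAt (fun τ => momentum L (v τ, deriv v τ) (ξ τ))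
      (force L (v t, deriv v t) (ξ t) + momentum L (v t, deriv v t) ξ') t :=
  (h.hasDerivAt_momentum t ht).clm_apply hξ

theorem hasDerivAt_energy (h : IsEulerLagrangeOn L Ω v J) (hJ : IsOpen J) (hΩ : IsOpen Ω)
    (hL : ContDiffOn ℝ ∞ L Ω) {t : ℝ} (ht : t ∈ J) :
    HasDerivAt (fun τ => momentum L (v τ, deriv v τ) (deriv v τ) - L (v τ, deriv v τ)) 0 t := by
  have h1 := (h.hasDerivAt_momentum_apply ht (h.hasDerivAt_deriv hJ ht)).sub
    (hasDerivAt_lagrangian hΩ hL (h.mem t ht) (h.hasDerivAt hJ ht) (h.hasDerivAt_deriv hJ ht))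
  rw [sub_self] at h1
  exact h1

end IsEulerLagrangeOn

/-- Differentiation under the integral sign for a function that is `C¹` around a compact segment of
parameters. -/
theorem hasDerivAt_integral_of_contDiffOn {G : ℝ × ℝ → ℝ} {U : Set (ℝ × ℝ)} (hU : IsOpen U)
    (hG : ContDiffOn ℝ 1 G U) {a b : ℝ} (hab : a ≤ b) (hsub : ∀ t ∈ Icc a b, ((0 : ℝ), t) ∈ U) :
    HasDerivAt (fun s => ∫ t in a..b, G (s, t)) (∫ t in a..b, fderiv ℝ G (0, t) (1, 0)) 0 := by
  -- The tube lemma yields a compact rectangle inside `U`, on which the parameter derivative is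
  -- bounded; that bound is the dominating constant.
  obtain ⟨A, B, hA, -, h0A, hKB, hAB⟩ := generalized_tube_lemma (isCompact_singleton (x := (0 : ℝ)))
    (isCompact_Icc (a := a) (b := b)) hU (by rintro ⟨s, t⟩ ⟨rfl, ht⟩; exact hsub t ht)
  obtain ⟨δ, hδ, hball⟩ := Metric.isOpen_iff.1 hA 0 (h0A rfl)
  have hK : Icc (-(δ / 2)) (δ / 2) ×ˢ Icc a b ⊆ U := by
    rintro ⟨s, t⟩ ⟨hs, ht⟩
    refine hAB ⟨hball ?_, hKB ht⟩
    rw [Metric.mem_ball, dist_zero_right, Real.norm_eq_abs, abs_lt]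
    constructor <;> linarith [hs.1, hs.2]
  have hG' : ContinuousOn (fun p => fderiv ℝ G p (1, 0)) U :=
    (hG.continuousOn_fderiv_of_isOpen hU le_rfl).clm_apply continuousOn_const
  obtain ⟨C, hC⟩ := (isCompact_Icc.prod isCompact_Icc).exists_bound_of_continuousOn (hG'.mono hK)
  have hslice : ∀ s ∈ Icc (-(δ / 2)) (δ / 2), ∀ f : ℝ × ℝ → ℝ, ContinuousOn f U →
      ContinuousOn (fun t => f (s, t)) (Icc a b) := fun s hs f hf =>
    hf.comp (by fun_prop) fun t ht => hK ⟨hs, ht⟩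
  have h0 : (0 : ℝ) ∈ Icc (-(δ / 2)) (δ / 2) := by constructor <;> linarith
  have hnhds : Icc (-(δ / 2)) (δ / 2) ∈ 𝓝 (0 : ℝ) := Icc_mem_nhds (by linarith) (by linarith)
  have hI : uIoc a b ⊆ Icc a b := by rw [uIoc_of_le hab]; exact Ioc_subset_Icc_self
  refine (intervalIntegral.hasDerivAt_integral_of_dominated_loc_of_deriv_le
    (F' := fun s t => fderiv ℝ G (s, t) (1, 0)) (bound := fun _ => C) hnhds ?_ ?_ ?_ ?_
    intervalIntegrable_const ?_).2
  · filter_upwards [hnhds] with s hs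
    exact ((hslice s hs G hG.continuousOn).mono hI).aestronglyMeasurable measurableSet_uIoc
  · exact ContinuousOn.intervalIntegrable
      (by rw [uIcc_of_le hab]; exact hslice 0 h0 G hG.continuousOn)
  · exact ((hslice 0 h0 _ hG').mono hI).aestronglyMeasurable measurableSet_uIoc
  · exact Eventually.of_forall fun t ht s hs => hC (s, t) ⟨hs, hI ht⟩
  · refine Eventually.of_forall fun t ht s hs => ?_
    have h1 : HasFDerivAt G (fderiv ℝ G (s, t)) (s, t) :=
      ((hG.contDiffAt (hU.mem_nhds (hK ⟨hs, hI ht⟩))).differentiableAt (by simp)).hasFDerivAt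
    exact h1.comp_hasDerivAt s ((hasDerivAt_id s).prodMk (hasDerivAt_const s t))

/-- A solution of the Euler-Lagrange equation is a critical point of the action under variations
with fixed end points. -/
theorem IsEulerLagrangeOn.hasDerivAt_action {v : ℝ → V} {J : Set ℝ} (h : IsEulerLagrangeOn L Ω v J)
    (hJ : IsOpen J) (hΩ : IsOpen Ω) (hL : ContDiffOn ℝ ∞ L Ω) {a b ε : ℝ} (hab : a < b)
    (hε : 0 < ε) (hsub : Icc a b ⊆ J) {η : ℝ × ℝ → V}
    (hη : ContDiffOn ℝ ∞ η (Ioo (-ε) ε ×ˢ J)) (hη0 : ∀ t ∈ J, η (0, t) = v t)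
    (hηa : ∀ s ∈ Ioo (-ε) ε, η (s, a) = v a) (hηb : ∀ s ∈ Ioo (-ε) ε, η (s, b) = v b) :
    HasDerivAt (fun s => ∫ t in a..b, L (η (s, t), fderiv ℝ η (s, t) (0, 1))) 0 0 := by
  set D : Set (ℝ × ℝ) := Ioo (-ε) ε ×ˢ J with hDdef
  have hD : IsOpen D := isOpen_Ioo.prod hJ
  have hmem0 : ∀ t ∈ J, ((0 : ℝ), t) ∈ D := fun t ht => ⟨by simp [hε], ht⟩
  have hη' : ContDiffOn ℝ ∞ (fderiv ℝ η) D := hη.fderiv_of_isOpen hD (by simp)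
  have hdη : ∀ p ∈ D, HasFDerivAt η (fderiv ℝ η p) p := fun p hp =>
    ((hη.contDiffAt (hD.mem_nhds hp)).differentiableAt (by simp)).hasFDerivAt
  have hdη' : ∀ p ∈ D, HasFDerivAt (fderiv ℝ η) (fderiv ℝ (fderiv ℝ η) p) p := fun p hp =>
    ((hη'.contDiffAt (hD.mem_nhds hp)).differentiableAt (by simp)).hasFDerivAt
  let lift : ℝ × ℝ → V × V := fun p => (η p, fderiv ℝ η p (0, 1))
  have hlift : ContDiffOn ℝ ∞ lift D := hη.prodMk (hη'.clm_apply contDiffOn_const)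
  have hlift0 : ∀ t ∈ J, lift (0, t) = (v t, deriv v t) := fun t ht => by
    have h1 : HasDerivAt (fun τ => η (0, τ)) (fderiv ℝ η (0, t) (0, 1)) t :=
      (hdη _ (hmem0 t ht)).comp_hasDerivAt t ((hasDerivAt_const t 0).prodMk (hasDerivAt_id t))
    have h2 : (fun τ => η (0, τ)) =ᶠ[𝓝 t] v := by
      filter_upwards [hJ.mem_nhds ht] with τ hτ using hη0 τ hτ
    simp only [lift, hη0 t ht, ← h1.deriv, h2.deriv_eq]
  -- A varied curve need not have its lift in `Ω`; over the compact interval it does for small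
  -- parameters, which is all the derivative at `0` sees.
  set U : Set (ℝ × ℝ) := D ∩ lift ⁻¹' Ω
  have hU : IsOpen U := hlift.continuousOn.isOpen_inter_preimage hD hΩ
  have hmemU : ∀ t ∈ J, ((0 : ℝ), t) ∈ U := fun t ht =>
    ⟨hmem0 t ht, by rw [mem_preimage, hlift0 t ht]; exact h.mem t ht⟩
  have hG : ContDiffOn ℝ ∞ (fun p => L (lift p)) U :=
    hL.comp (hlift.mono inter_subset_left) inter_subset_right
  have key := hasDerivAt_integral_of_contDiffOn hU (hG.of_le (by exact_mod_cast le_top)) hab.le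
    fun t ht => hmemU t (hsub ht)
  let ξ : ℝ → V := fun t => fderiv ℝ η (0, t) (1, 0)
  have hξ : ∀ t ∈ J, HasDerivAt ξ (fderiv ℝ (fderiv ℝ η) (0, t) (0, 1) (1, 0)) t := fun t ht => by
    have h1 := ((hdη' _ (hmem0 t ht)).comp_hasDerivAt t
      ((hasDerivAt_const t 0).prodMk (hasDerivAt_id t))).clm_apply
      (hasDerivAt_const t ((1 : ℝ), (0 : ℝ)))
    simpa using h1
  -- The Euler-Lagrange equation turns the varied integrand into the total time derivative of the
  -- momentum paired with the variation field `ξ`.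
  have hint : ∀ t ∈ J, HasDerivAt (fun τ => momentum L (v τ, deriv v τ) (ξ τ))
      (fderiv ℝ (fun p => L (lift p)) (0, t) (1, 0)) t := fun t ht => by
    have h1 := h.hasDerivAt_momentum_apply ht (hξ t ht)
    have h2 : HasFDerivAt lift ((fderiv ℝ η (0, t)).prod
        (((ContinuousLinearMap.apply ℝ V ((0 : ℝ), (1 : ℝ)))).comp
          (fderiv ℝ (fderiv ℝ η) (0, t)))) (0, t) :=
      (hdη _ (hmem0 t ht)).prodMk
        ((ContinuousLinearMap.apply ℝ V ((0 : ℝ), (1 : ℝ))).hasFDerivAt.comp _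
          (hdη' _ (hmem0 t ht)))
    have h3 := (hasFDerivAt_lagrangian hΩ hL (hmemU t ht).2).comp _ h2
    -- Symmetry of the second derivative: the variation of the velocity is the time derivative of
    -- `ξ`.
    have hsymm : IsSymmSndFDerivAt ℝ η (0, t) :=
      (hη.contDiffAt (hD.mem_nhds (hmem0 t ht))).isSymmSndFDerivAt
        (by simpa using WithTop.coe_le_coe.2 (le_top : (2 : ℕ∞) ≤ ⊤))
    have h4 : fderiv ℝ (fun p => L (lift p)) (0, t) (1, 0) =
        force L (v t, deriv v t) (ξ t) +
          momentum L (v t, deriv v t) (fderiv ℝ (fderiv ℝ η) (0, t) (0, 1) (1, 0)) := by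
      rw [← fderiv_eq_force_add_momentum, ← hlift0 t ht, hsymm.eq]
      exact DFunLike.congr_fun h3.fderiv ((1 : ℝ), (0 : ℝ))
    rw [h4]; exact h1
  have hcontG : ContinuousOn (fun t => fderiv ℝ (fun p => L (lift p)) (0, t) (1, 0)) (Icc a b) :=
    ((hG.continuousOn_fderiv_of_isOpen hU (by simp)).clm_apply continuousOn_const).comp
      (f := fun t => ((0 : ℝ), t)) (by fun_prop) fun t ht => hmemU t (hsub ht)
  have hend : ∀ c ∈ J, (∀ s ∈ Ioo (-ε) ε, η (s, c) = v c) → ξ c = 0 := fun c hc hfix => by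
    have h1 : HasDerivAt (fun s => η (s, c)) (ξ c) 0 :=
      (hdη _ (hmem0 c hc)).comp_hasDerivAt 0 ((hasDerivAt_id 0).prodMk (hasDerivAt_const 0 c))
    have h2 : (fun s => η (s, c)) =ᶠ[𝓝 0] fun _ => v c := by
      filter_upwards [Ioo_mem_nhds (neg_lt_zero.2 hε) hε] with s hs using hfix s hs
    rw [← h1.deriv, h2.deriv_eq, deriv_const]
  have hzero : ∫ t in a..b, fderiv ℝ (fun p => L (lift p)) (0, t) (1, 0) = 0 := by
    rw [intervalIntegral.integral_eq_sub_of_hasDerivAt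
      (fun t ht => hint t (hsub (by rwa [uIcc_of_le hab.le] at ht)))
      (ContinuousOn.intervalIntegrable (by rwa [uIcc_of_le hab.le])),
      hend a (hsub (left_mem_Icc.2 hab.le)) hηa, hend b (hsub (right_mem_Icc.2 hab.le)) hηb]
    simp
  rw [hzero] at key
  exact key

end Lagrangian

/-! ### The radial projection onto the unit sphere -/

section SphereProjection

open Set Filter Topology Module Metric
open scoped InnerProductSpace

variable {E : Type*} [NormedAddCommGroup E] [InnerProductSpace ℝ E]

/-- The radial projection of `E \ {0}` onto the unit sphere. -/
def sphereProj [Nonempty (sphere (0 : E) 1)] (v : E) : sphere (0 : E) 1 :=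
  open Classical in
  if h : v ≠ 0 then ⟨‖v‖⁻¹ • v, by simp [norm_smul, h]⟩ else Classical.arbitrary _

theorem tangentBundle_mk_congr {d : ℕ} {M : Type*} [TopologicalSpace M]
    [ChartedSpace (EuclideanSpace ℝ (Fin d)) M] {x x' : M} {y : TangentSpace (𝓡 d) x}
    {y' : TangentSpace (𝓡 d) x'} (hx : x = x') (hy : (y : EuclideanSpace ℝ (Fin d)) = y') :
    (⟨x, y⟩ : TangentBundle (𝓡 d) M) = ⟨x', y'⟩ := by
  subst hx; exact congrArg _ hy

section

variable {d : ℕ} [Fact (finrank ℝ E = d + 1)]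

/-- The charts are stereographic projections, which extend to ambient maps smooth off the hyperplane
tangent at the pole, so smoothness can be tested in `E`. -/
theorem contMDiffOn_of_coe_sphere {U : Set E} {f : E → sphere (0 : E) 1}
    (hf : ContDiffOn ℝ ∞ (fun v => (f v : E)) U) :
    ContMDiffOn 𝓘(ℝ, E) (𝓡 d) ∞ f U := by
  rw [contMDiffOn_iff_target]
  refine ⟨continuousOn_iff_continuous_domRestrict.2
    (continuous_induced_rng.2 (continuousOn_iff_continuous_domRestrict.1 hf.continuousOn)), ?_⟩
  intro v
  let U : _ ≃ₗᵢ[ℝ] _ :=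
    (OrthonormalBasis.fromOrthogonalSpanSingleton (𝕜 := ℝ) d (ne_zero_of_mem_unit_sphere (-v))).repr
  have h : ContDiffOn ℝ ω _ Set.univ := U.contDiff.contDiffOn
  have H₁ := (h.comp_inter contDiffOn_stereoToFun).contMDiffOn
  have H₂ := hf.contMDiffOn
  convert! (H₁.of_le le_top).comp' H₂ using 1
  ext x
  -- On unit vectors, that hyperplane meets the sphere only at the pole `-v`.
  have hfxv : (f x : E) = -↑v ↔ ⟪(f x : E), -↑v⟫_ℝ = 1 := by
    have hfx : ‖(f x : E)‖ = 1 := by simp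
    rw [inner_eq_one_iff_of_norm_eq_one hfx]
    exact norm_eq_of_mem_sphere (-v)
  simp [chartAt, ChartedSpace.chartAt, Subtype.ext_iff, hfxv, real_inner_comm]

theorem mdifferentiableAt_coe_sphere (x : sphere (0 : E) 1) :
    MDifferentiableAt (𝓡 d) 𝓘(ℝ, E) ((↑) : sphere (0 : E) 1 → E) x :=
  (contMDiff_coe_sphere (m := 1) x).mdifferentiableAt one_ne_zero

theorem inner_coe_mfderiv_coe (x : sphere (0 : E) 1) (y : TangentSpace (𝓡 d) x) :
    ⟪(x : E), (mfderiv (𝓡 d) 𝓘(ℝ, E) ((↑) : sphere (0 : E) 1 → E) x y : E)⟫_ℝ = 0 := by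
  have h := mfderiv_comp_apply (I := 𝓡 d) (I' := 𝓘(ℝ, E)) (I'' := 𝓘(ℝ, ℝ)) x
    (g := fun v : E => ‖v‖ ^ 2) (contDiff_norm_sq ℝ (n := 1)).differentiable_one.differentiableAt.mdifferentiableAt
    (mdifferentiableAt_coe_sphere x) y
  have h2 : (fun v : E => ‖v‖ ^ 2) ∘ ((↑) : sphere (0 : E) 1 → E) = fun _ => 1 := by
    funext z; simp
  rw [h2, mfderiv_const, mfderiv_eq_fderiv, fderiv_norm_sq] at h
  have h3 : (0 : ℝ) = 2 * ⟪(x : E), (mfderiv (𝓡 d) 𝓘(ℝ, E) ((↑) : sphere (0 : E) 1 → E) x y : E)⟫_ℝ := by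
    refine Eq.trans h ?_
    change (2 • innerSL ℝ (x : E)) (mfderiv (𝓡 d) 𝓘(ℝ, E) ((↑) : sphere (0 : E) 1 → E) x y) = _
    rw [two_smul, two_mul]; rfl
  linarith

end

variable [Nonempty (sphere (0 : E) 1)]

theorem coe_sphereProj {v : E} (h : v ≠ 0) : (sphereProj v : E) = ‖v‖⁻¹ • v := by
  simp [sphereProj, h]

@[simp]
theorem sphereProj_coe (x : sphere (0 : E) 1) : sphereProj (x : E) = x :=
  Subtype.ext (by rw [coe_sphereProj (ne_zero_of_mem_unit_sphere x)]; simp)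

theorem sphereProj_smul {r : ℝ} (hr : 0 < r) (v : E) : sphereProj (r • v) = sphereProj v := by
  by_cases h : v = 0
  · simp [h]
  · refine Subtype.ext ?_
    rw [coe_sphereProj h, coe_sphereProj (smul_ne_zero hr.ne' h), norm_smul, Real.norm_of_nonneg
      hr.le, smul_smul, mul_inv, mul_right_comm, inv_mul_cancel₀ hr.ne', one_mul]

variable {d : ℕ} [Fact (finrank ℝ E = d + 1)]

theorem contMDiffOn_sphereProj :
    ContMDiffOn 𝓘(ℝ, E) (𝓡 d) ∞ (sphereProj : E → sphere (0 : E) 1) {0}ᶜ := by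
  refine contMDiffOn_of_coe_sphere (ContDiffOn.congr (f := fun v => ‖v‖⁻¹ • v) ?_
    fun v hv => coe_sphereProj hv)
  exact ((contDiffOn_id.norm ℝ fun v hv => hv).inv fun v (hv : v ≠ 0) => norm_ne_zero_iff.2 hv).smul
    contDiffOn_id

theorem mdifferentiableAt_sphereProj {v : E} (hv : v ≠ 0) :
    MDifferentiableAt 𝓘(ℝ, E) (𝓡 d) (sphereProj : E → sphere (0 : E) 1) v :=
  (contMDiffOn_sphereProj.contMDiffAt (isOpen_compl_singleton.mem_nhds hv)).mdifferentiableAt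
    (by simp)

variable (d) in
/-- The differential of the radial projection. -/
def sphereDiff (v : E) : E →L[ℝ] TangentSpace (𝓡 d) (sphereProj v : sphere (0 : E) 1) :=
  mfderiv 𝓘(ℝ, E) (𝓡 d) (sphereProj : E → sphere (0 : E) 1) v

variable (d) in
/-- The tangent map of the radial projection. -/
def sphereLift (z : E × E) : TangentBundle (𝓡 d) (sphere (0 : E) 1) :=
  ⟨sphereProj z.1, sphereDiff d z.1 z.2⟩

theorem velocity_eq_sphereLift {c : ℝ → sphere (0 : E) 1} {v : ℝ → E} {t : ℝ} {w : E}
    (hv : HasDerivAt v w t) (hne : v t ≠ 0) (hc : c =ᶠ[𝓝 t] fun τ => sphereProj (v τ)) :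
    velocity (d := d) c t = sphereLift d (v t, w) := by
  refine tangentBundle_mk_congr hc.eq_of_nhds ?_
  have h1 : mfderiv 𝓘(ℝ, ℝ) 𝓘(ℝ, E) v t (1 : ℝ) = w := by
    rw [mfderiv_eq_fderiv]
    change fderiv ℝ v t 1 = w
    rw [hv.hasFDerivAt.fderiv]; simp
  have h2 := mfderiv_comp_apply (I := 𝓘(ℝ, ℝ)) (I' := 𝓘(ℝ, E)) (I'' := 𝓡 d) t
    (mdifferentiableAt_sphereProj hne) hv.differentiableAt.mdifferentiableAt (1 : ℝ)
  rw [h1] at h2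
  rw [hc.mfderiv_eq]
  exact h2

theorem sphereLift_map {g : sphere (0 : E) 1 → sphere (0 : E) 1} {T : E →L[ℝ] E} {v w : E}
    (hg : MDifferentiableAt (𝓡 d) (𝓡 d) g (sphereProj v)) (hv : v ≠ 0) (hTv : T v ≠ 0)
    (h : (fun u => sphereProj (T u)) =ᶠ[𝓝 v] fun u => g (sphereProj u)) :
    sphereLift d (T v, T w) =
      ⟨g (sphereProj v), mfderiv (𝓡 d) (𝓡 d) g (sphereProj v) (sphereDiff d v w)⟩ := by
  refine tangentBundle_mk_congr h.eq_of_nhds ?_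
  have h1 : mfderiv 𝓘(ℝ, E) 𝓘(ℝ, E) T v w = T w := by
    rw [mfderiv_eq_fderiv]
    change fderiv ℝ T v w = T w
    rw [T.fderiv]
  have h2 := mfderiv_comp_apply (I := 𝓘(ℝ, E)) (I' := 𝓘(ℝ, E)) (I'' := 𝓡 d) v
    (mdifferentiableAt_sphereProj hTv) T.differentiableAt.mdifferentiableAt w
  have h3 := mfderiv_comp_apply (I := 𝓘(ℝ, E)) (I' := 𝓡 d) (I'' := 𝓡 d) v
    hg (mdifferentiableAt_sphereProj hv) w
  rw [h1] at h2
  have h4 : mfderiv 𝓘(ℝ, E) (𝓡 d) (sphereProj ∘ T) v = mfderiv 𝓘(ℝ, E) (𝓡 d) (g ∘ sphereProj) v :=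
    h.mfderiv_eq
  rw [h4] at h2
  exact h2.symm.trans h3

theorem sphereLift_smul {r : ℝ} (hr : 0 < r) {v : E} (hv : v ≠ 0) (w : E) :
    sphereLift d (r • v, r • w) = sphereLift d (v, w) := by
  have h := sphereLift_map (d := d) (g := id) (T := r • ContinuousLinearMap.id ℝ E) (w := w)
    mdifferentiableAt_id hv (smul_ne_zero hr.ne' hv)
    (Eventually.of_forall fun u => sphereProj_smul hr u)
  rw [mfderiv_id] at h
  exact h

theorem sphereLift_coe (x : sphere (0 : E) 1) (y : TangentSpace (𝓡 d) x) :
    sphereLift d ((x : E), mfderiv (𝓡 d) 𝓘(ℝ, E) ((↑) : sphere (0 : E) 1 → E) x y) = ⟨x, y⟩ := by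
  refine tangentBundle_mk_congr (sphereProj_coe x) ?_
  have h := mfderiv_comp_apply (I := 𝓡 d) (I' := 𝓘(ℝ, E)) (I'' := 𝓡 d) x
    (mdifferentiableAt_sphereProj (ne_zero_of_mem_unit_sphere x))
    (mdifferentiableAt_coe_sphere x) y
  have h2 : sphereProj ∘ ((↑) : sphere (0 : E) 1 → E) = id := funext sphereProj_coe
  rw [h2, mfderiv_id] at h
  exact h.symm

/-- The kernel is the radial line. Differentiating `u = ‖u‖ • sphereProj u` splits `w` into a
multiple of the image `D` of its differential and a radial part; the inclusion of the sphere is an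
immersion, so the differential kills `w` exactly when `D = 0`. -/
theorem sphereDiff_eq_zero_iff {v : E} (hv : v ≠ 0) (w : E) :
    sphereDiff d v w = 0 ↔ ‖v‖ ^ 2 • w = ⟪v, w⟫_ℝ • v := by
  have hn : ‖v‖ ≠ 0 := norm_ne_zero_iff.2 hv
  have hline : HasDerivAt (fun t : ℝ => v + t • w) w 0 := by
    simpa using ((hasDerivAt_id (0 : ℝ)).smul_const w).const_add v
  have hline0 : v + (0 : ℝ) • w = v := by simp
  obtain ⟨N, hN⟩ : ∃ N : ℝ, HasDerivAt (fun t : ℝ => ‖v + t • w‖) N 0 :=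
    ⟨_, (hline.differentiableAt.norm ℝ (by rwa [hline0])).hasDerivAt⟩
  have hsq : ‖v‖ * N = ⟪v, w⟫_ℝ := by
    have h := (hN.pow 2).unique hline.norm_sq
    rw [hline0] at h
    simp at h
    linarith
  set D : E := mfderiv (𝓡 d) 𝓘(ℝ, E) ((↑) : sphere (0 : E) 1 → E) (sphereProj v)
    (sphereDiff d v w) with hD
  have hP : HasDerivAt (fun t : ℝ => (sphereProj (v + t • w) : E)) D 0 := by
    have h1 := (mdifferentiableAt_coe_sphere (d := d) (sphereProj v)).comp v
      (mdifferentiableAt_sphereProj hv)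
    have h2 := h1.differentiableAt.hasFDerivAt
    rw [← mfderiv_eq_fderiv, ← hline0] at h2
    have h3 := h2.comp_hasDerivAt 0 hline
    rw [hline0] at h3
    have h4 := mfderiv_comp_apply v (mdifferentiableAt_coe_sphere (d := d) (sphereProj v))
      (mdifferentiableAt_sphereProj hv) w
    exact h3.congr_deriv h4
  have hprod : w = ‖v‖ • D + N • (‖v‖⁻¹ • v) := by
    have h1 := hN.smul hP
    have h2 : (fun t : ℝ => v + t • w) =ᶠ[𝓝 0]
        (fun t : ℝ => ‖v + t • w‖ • (sphereProj (v + t • w) : E)) := by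
      filter_upwards [hline.continuousAt.eventually_ne (y := 0) (by rwa [hline0])] with t ht
      rw [coe_sphereProj ht, smul_inv_smul₀ (norm_ne_zero_iff.2 ht)]
    have h3 := hline.unique (h1.congr_of_eventuallyEq h2)
    rw [hline0, coe_sphereProj hv] at h3
    exact h3
  have hDw : ‖v‖ ^ 2 • w = ‖v‖ ^ 3 • D + ⟪v, w⟫_ℝ • v := by
    rw [← hsq]
    nth_rw 1 [hprod]
    rw [smul_add, smul_smul, smul_smul, smul_smul]
    congr 2
    field_simp
  have hinj : Function.Injective (mfderiv (𝓡 d) 𝓘(ℝ, E) ((↑) : sphere (0 : E) 1 → E)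
      (sphereProj v)) := by
    convert! injective_mvfderiv_subtypeVal_sphere (n := d) (sphereProj v)
  constructor
  · intro h
    have : D = 0 := by rw [hD, h]; exact map_zero _
    rw [hDw, this, smul_zero, zero_add]
  · intro h
    have h1 : ‖v‖ ^ 3 • D = 0 := by rw [← sub_eq_zero.2 h, hDw, add_sub_cancel_right]
    have h0 : D = 0 := (smul_eq_zero.1 h1).resolve_left (pow_ne_zero 3 hn)
    exact hinj (h0.trans (map_zero _).symm)

end SphereProjection

/-! ### The Lagrangian of a Finsler metric on the sphere, extended to the ambient space -/

theorem FinslerMetric.toFun_nonneg {d : ℕ} {M : Type*} [TopologicalSpace M]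
    [ChartedSpace (EuclideanSpace ℝ (Fin d)) M] [IsManifold (𝓡 d) ∞ M] (F : FinslerMetric d M)
    (p : TangentBundle (𝓡 d) M) : 0 ≤ F.toFun p := by
  obtain ⟨x, y⟩ := p
  by_cases hy : y = 0
  · have h := F.homogeneous x y 0 le_rfl
    rw [zero_smul, zero_mul, ← hy] at h
    exact h.ge
  · exact (F.pos_off_zero x y hy).le

section SphereLagrangian

open Set Filter Topology Module Metric
open scoped InnerProductSpace

/-- The pairs `(v, w)` with `v ≠ 0` for which the radial projection does not kill `w` at `v`. -/
def nonradial (E : Type*) [NormedAddCommGroup E] [InnerProductSpace ℝ E] : Set (E × E) :=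
  {z | z.1 ≠ 0 ∧ ‖z.1‖ ^ 2 • z.2 - ⟪z.1, z.2⟫_ℝ • z.1 ≠ 0}

variable {E : Type*} [NormedAddCommGroup E] [InnerProductSpace ℝ E]

theorem isOpen_nonradial : IsOpen (nonradial E) := by
  refine (isOpen_ne_fun continuous_fst continuous_const).inter
    (isOpen_ne_fun (f := fun z : E × E => ‖z.1‖ ^ 2 • z.2 - ⟪z.1, z.2⟫_ℝ • z.1)
      (by fun_prop) continuous_const)

theorem mem_nonradial_of_inner_eq_zero {v w : E} (hv : v ≠ 0) (hw : w ≠ 0) (h : ⟪v, w⟫_ℝ = 0) :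
    (v, w) ∈ nonradial E := by
  refine ⟨hv, ?_⟩
  simp [h, hv, hw]

theorem contDiffOn_radialTerm :
    ContDiffOn ℝ ∞ (fun z : E × E => (⟪z.1, z.2⟫_ℝ / ‖z.1‖ ^ 2) ^ 2 / 2) (nonradial E) := by
  refine (ContDiffOn.pow (ContDiffOn.div (contDiffOn_fst.inner ℝ contDiffOn_snd) ?_ fun z hz => ?_) 2).div_const 2
  · exact (contDiffOn_fst.norm_sq ℝ)
  · exact pow_ne_zero 2 (norm_ne_zero_iff.2 hz.1)

variable [Nonempty (sphere (0 : E) 1)] {d : ℕ} [Fact (finrank ℝ E = d + 1)]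

theorem sphereDiff_ne_zero {z : E × E} (hz : z ∈ nonradial E) : sphereDiff d z.1 z.2 ≠ 0 :=
  fun h => hz.2 (sub_eq_zero.2 ((sphereDiff_eq_zero_iff hz.1 z.2).1 h))

theorem sphereLift_add_smul (v w u : E) (t : ℝ) :
    sphereLift d (v, w + t • u) =
      ⟨sphereProj v, sphereDiff d v w + t • sphereDiff d v u⟩ := by
  simp only [sphereLift, map_add, map_smul]

theorem sphereLift_add_radial {v : E} (hv : v ≠ 0) (w : E) (t : ℝ) :
    sphereLift d (v, w + t • v) = sphereLift d (v, w) := by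
  rw [sphereLift_add_smul, (sphereDiff_eq_zero_iff hv v).2 (by rw [real_inner_self_eq_norm_sq]),
    smul_zero, add_zero, sphereLift]

theorem sphereLift_smul_right (v w : E) (t : ℝ) :
    sphereLift d (v, t • w) = ⟨sphereProj v, t • sphereDiff d v w⟩ := by
  simp only [sphereLift, map_smul]

theorem contMDiffOn_sphereLift :
    ContMDiffOn 𝓘(ℝ, E × E) (𝓡 d).tangent ∞ (sphereLift d : E × E → _) {z | z.1 ≠ 0} := by
  have h1 := (contMDiffOn_sphereProj (E := E) (d := d)).contMDiffOn_tangentMapWithin (m := ∞)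
    (by simp) isOpen_compl_singleton.uniqueMDiffOn
  have h2 : ContMDiff 𝓘(ℝ, E × E) 𝓘(ℝ, E).tangent ∞
      (fun z : E × E => (⟨z.1, z.2⟩ : TangentBundle 𝓘(ℝ, E) E)) := by
    have h3 := contMDiff_tangentBundleModelSpaceHomeomorph_symm (I := 𝓘(ℝ, E)) (n := ∞)
    rw [modelWithCornersSelf_prod]
    exact h3
  refine (h1.comp h2.contMDiffOn fun z hz => hz).congr fun z hz => ?_
  refine tangentBundle_mk_congr rfl ?_
  rw [mfderivWithin_of_isOpen isOpen_compl_singleton hz]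
  rfl

variable (F : FinslerMetric d (sphere (0 : E) 1))

namespace FinslerMetric

theorem contDiffOn_toFun_sphereLift :
    ContDiffOn ℝ ∞ (fun z => F.toFun (sphereLift d z)) (nonradial E) := by
  rw [← contMDiffOn_iff_contDiffOn]
  exact F.smooth_off_zero.comp (contMDiffOn_sphereLift.mono fun z hz => hz.1)
    fun z hz => sphereDiff_ne_zero hz

/-- The energy density of `F`, pulled back by the radial projection, plus a radial term that makes
it nondegenerate. -/
def sphereLagrangian (z : E × E) : ℝ :=
  F.toFun (sphereLift d z) ^ 2 / 2 + (⟪z.1, z.2⟫_ℝ / ‖z.1‖ ^ 2) ^ 2 / 2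

theorem sphereLagrangian_of_inner_eq_zero {z : E × E} (h : ⟪z.1, z.2⟫_ℝ = 0) :
    F.sphereLagrangian z = F.toFun (sphereLift d z) ^ 2 / 2 := by
  simp [sphereLagrangian, h]

theorem contDiffOn_sphereLagrangian : ContDiffOn ℝ ∞ F.sphereLagrangian (nonradial E) :=
  ((F.contDiffOn_toFun_sphereLift.pow 2).div_const 2).add contDiffOn_radialTerm

/-- For radial `u` the Finsler part is constant along the line and the extra term contributes `b ^ 2
> 0`; for any other `u` the Finsler Hessian is already positive. -/
theorem sphereLagrangian_hessian_pos {z : E × E} (hz : z ∈ nonradial E) {u : E} (hu : u ≠ 0) :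
    0 < iteratedDeriv 2 (fun t : ℝ => F.sphereLagrangian (z.1, z.2 + t • u)) 0 := by
  obtain ⟨v, w⟩ := z
  have hv : v ≠ 0 := hz.1
  have hn : ‖v‖ ^ 2 ≠ 0 := pow_ne_zero 2 (norm_ne_zero_iff.2 hv)
  have hline : ContDiff ℝ ∞ fun t : ℝ => (v, w + t • u) := by fun_prop
  have hmem : (v, w + (0 : ℝ) • u) ∈ nonradial E := by rwa [zero_smul, add_zero]
  have h1 : ContDiffAt ℝ 2 (fun t : ℝ => F.toFun (sphereLift d (v, w + t • u)) ^ 2 / 2) 0 :=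
    (((((F.contDiffOn_toFun_sphereLift.pow 2).div_const 2).contDiffAt
      (isOpen_nonradial.mem_nhds hmem)).of_le
        (WithTop.coe_le_coe.2 (le_top : (2 : ℕ∞) ≤ ⊤))).comp (0 : ℝ)
          (f := fun t : ℝ => (v, w + t • u)) (hline.contDiffAt.of_le
        (WithTop.coe_le_coe.2 (le_top : (2 : ℕ∞) ≤ ⊤))))
  set a : ℝ := ⟪v, w⟫_ℝ / ‖v‖ ^ 2
  set b : ℝ := ⟪v, u⟫_ℝ / ‖v‖ ^ 2 with hb
  have h2 : (fun t : ℝ => (⟪v, w + t • u⟫_ℝ / ‖v‖ ^ 2) ^ 2 / 2) =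
      fun t : ℝ => (a + t * b) ^ 2 / 2 := by
    funext t
    rw [inner_add_right, inner_smul_right]
    ring
  have h3 : iteratedDeriv 2 (fun t : ℝ => (a + t * b) ^ 2 / 2) 0 = b ^ 2 := by
    have hd : deriv (fun t : ℝ => (a + t * b) ^ 2 / 2) = fun t => (a + t * b) * b := by
      funext t
      have h := ((((hasDerivAt_id t).mul_const b).const_add a).pow 2).div_const 2
      refine h.deriv.trans ?_
      simp; ring
    rw [iteratedDeriv_succ, iteratedDeriv_one, hd]
    have h := (((hasDerivAt_id (0 : ℝ)).mul_const b).const_add a).mul_const b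
    refine h.deriv.trans ?_
    simp; ring
  have h4 : iteratedDeriv 2 (fun t : ℝ => F.sphereLagrangian (v, w + t • u)) 0 =
      iteratedDeriv 2 (fun t : ℝ => F.toFun (sphereLift d (v, w + t • u)) ^ 2 / 2) 0 + b ^ 2 := by
    rw [← h3, ← h2]
    refine iteratedDeriv_fun_add h1 ?_
    rw [h2]
    fun_prop
  change 0 < iteratedDeriv 2 (fun t : ℝ => F.sphereLagrangian (v, w + t • u)) 0
  rw [h4]
  simp only [sphereLift_add_smul]
  by_cases hy : sphereDiff d v u = 0
  · have h5 := (sphereDiff_eq_zero_iff hv u).1 hy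
    have hb0 : b ≠ 0 := by
      rw [hb, div_ne_zero_iff]
      refine ⟨fun h => ?_, hn⟩
      rw [h, zero_smul] at h5
      exact (smul_ne_zero hn hu) h5
    simp only [hy, smul_zero, add_zero]
    rw [iteratedDeriv_succ, iteratedDeriv_one]
    simp only [deriv_const', deriv_const, zero_add]
    positivity
  · have h6 := F.hessian_pos (sphereProj v) (sphereDiff d v w) (sphereDiff d v u)
      (sphereDiff_ne_zero hz) hy
    exact add_pos_of_pos_of_nonneg h6 (sq_nonneg b)

theorem sphereLagrangian_smul {r : ℝ} (hr : 0 < r) {v : E} (hv : v ≠ 0) (w : E) :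
    F.sphereLagrangian (r • v, r • w) = F.sphereLagrangian (v, w) := by
  simp only [sphereLagrangian, sphereLift_smul hr hv, inner_smul_left, inner_smul_right, norm_smul,
    Real.norm_of_nonneg hr.le, RCLike.conj_to_real]
  have : r ≠ 0 := hr.ne'
  have : ‖v‖ ≠ 0 := norm_ne_zero_iff.2 hv
  congr 3
  field_simp

theorem sphereLagrangian_smul_right {r : ℝ} (hr : 0 < r) (v w : E) :
    F.sphereLagrangian (v, r • w) = r ^ 2 * F.sphereLagrangian (v, w) := by
  simp only [sphereLagrangian, sphereLift_smul_right, inner_smul_right]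
  rw [F.homogeneous _ _ r hr.le]
  change (r * F.toFun (sphereLift d (v, w))) ^ 2 / 2 + _ = _
  ring

/-- Derivative at `t = 1` of the scaling invariance `L(tv, tw) = L(v, w)`; through Noether's theorem
it conserves the radial momentum. -/
theorem force_add_momentum_self {z : E × E} (hz : z ∈ nonradial E) :
    force F.sphereLagrangian z z.1 + momentum F.sphereLagrangian z z.2 = 0 := by
  obtain ⟨v, w⟩ := z
  have hid : ∀ u : E, HasDerivAt (fun t : ℝ => t • u) u 1 := fun u => by
    simpa using (hasDerivAt_id (1 : ℝ)).smul_const u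
  have h1 := hasDerivAt_lagrangian isOpen_nonradial F.contDiffOn_sphereLagrangian
    (x := fun t : ℝ => t • v) (y := fun t : ℝ => t • w) (t := 1) (by simpa using hz) (hid v) (hid w)
  have h2 : (fun t : ℝ => F.sphereLagrangian (t • v, t • w)) =ᶠ[𝓝 1]
      fun _ => F.sphereLagrangian (v, w) := by
    filter_upwards [lt_mem_nhds (zero_lt_one' ℝ)] with t ht
    exact F.sphereLagrangian_smul ht hz.1 w
  have h3 := h1.unique ((hasDerivAt_const _ _).congr_of_eventuallyEq h2)
  simpa using h3

/-- Euler's identity for degree two in the velocity; it identifies the conserved energy with the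
Lagrangian itself. -/
theorem momentum_velocity {z : E × E} (hz : z ∈ nonradial E) :
    momentum F.sphereLagrangian z z.2 = 2 * F.sphereLagrangian z := by
  obtain ⟨v, w⟩ := z
  have hid : HasDerivAt (fun t : ℝ => t • w) w 1 := by
    simpa using (hasDerivAt_id (1 : ℝ)).smul_const w
  have h1 := hasDerivAt_lagrangian isOpen_nonradial F.contDiffOn_sphereLagrangian
    (x := fun _ : ℝ => v) (y := fun t : ℝ => t • w) (t := 1) (by simpa using hz)
    (hasDerivAt_const _ v) hid
  have h2 : (fun t : ℝ => F.sphereLagrangian (v, t • w)) =ᶠ[𝓝 1]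
      fun t => t ^ 2 * F.sphereLagrangian (v, w) := by
    filter_upwards [lt_mem_nhds (zero_lt_one' ℝ)] with t ht
    exact F.sphereLagrangian_smul_right ht v w
  have h3 := h1.unique ((((hasDerivAt_id (1 : ℝ)).pow 2).mul_const _).congr_of_eventuallyEq h2)
  simpa using h3

/-- The Finsler part does not change when a multiple of `v` is added to the velocity, so only the
extra term contributes. -/
theorem momentum_position {z : E × E} (hz : z ∈ nonradial E) :
    momentum F.sphereLagrangian z z.1 = ⟪z.1, z.2⟫_ℝ / ‖z.1‖ ^ 2 := by
  obtain ⟨v, w⟩ := z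
  have hv : v ≠ 0 := hz.1
  have hn : ‖v‖ ^ 2 ≠ 0 := pow_ne_zero 2 (norm_ne_zero_iff.2 hv)
  have hid : HasDerivAt (fun t : ℝ => w + t • v) v 0 := by
    simpa using ((hasDerivAt_id (0 : ℝ)).smul_const v).const_add w
  have h1 := hasDerivAt_lagrangian isOpen_nonradial F.contDiffOn_sphereLagrangian
    (x := fun _ : ℝ => v) (y := fun t : ℝ => w + t • v) (t := 0) (by simpa using hz)
    (hasDerivAt_const _ v) hid
  have h2 : (fun t : ℝ => F.sphereLagrangian (v, w + t • v)) =
      fun t => F.toFun (sphereLift d (v, w)) ^ 2 / 2 + (⟪v, w⟫_ℝ / ‖v‖ ^ 2 + t) ^ 2 / 2 := by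
    funext t
    simp only [sphereLagrangian, sphereLift_add_radial hv, inner_add_right, inner_smul_right,
      real_inner_self_eq_norm_sq]
    congr 3
    field_simp
  rw [h2] at h1
  have h3 := h1.unique (((((hasDerivAt_id (0 : ℝ)).const_add _).pow 2).div_const 2).const_add _)
  simpa using h3

end FinslerMetric
end SphereLagrangian

/-! ### Existence of geodesics on the sphere -/

section SphereGeodesics

open Set Filter Topology Module Metric
open scoped InnerProductSpace

theorem eq_zero_time_of_hasDerivAt_zero {f : ℝ → ℝ} {ε : ℝ}
    (hf : ∀ t ∈ Ioo (-ε) ε, HasDerivAt f 0 t) {t : ℝ} (ht : t ∈ Ioo (-ε) ε) : f t = f 0 := by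
  have h0 : (0 : ℝ) ∈ Ioo (-ε) ε := by constructor <;> linarith [ht.1, ht.2]
  exact isOpen_Ioo.is_const_of_deriv_eq_zero isPreconnected_Ioo
    (fun s hs => (hf s hs).differentiableAt.differentiableWithinAt) (fun s hs => (hf s hs).deriv)
    ht h0

variable {E : Type*} [NormedAddCommGroup E] [InnerProductSpace ℝ E]
  [Nonempty (sphere (0 : E) 1)] {d : ℕ} [Fact (finrank ℝ E = d + 1)]
  (F : FinslerMetric d (sphere (0 : E) 1))

namespace IsEulerLagrangeOn

variable {F} {v : ℝ → E} {ε : ℝ}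

/-- The radial momentum is conserved and vanishes exactly when position and velocity are orthogonal.
-/
theorem inner_deriv_eq_zero (h : IsEulerLagrangeOn F.sphereLagrangian (nonradial E) v (Ioo (-ε) ε))
    (hi : ⟪v 0, deriv v 0⟫_ℝ = 0) {t : ℝ} (ht : t ∈ Ioo (-ε) ε) : ⟪v t, deriv v t⟫_ℝ = 0 := by
  have hder : ∀ t ∈ Ioo (-ε) ε,
      HasDerivAt (fun τ => momentum F.sphereLagrangian (v τ, deriv v τ) (v τ)) 0 t :=
    fun t ht => by
      have h1 := h.hasDerivAt_momentum_apply ht (h.hasDerivAt isOpen_Ioo ht)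
      rwa [F.force_add_momentum_self (h.mem t ht)] at h1
  have h0 : (0 : ℝ) ∈ Ioo (-ε) ε := by constructor <;> linarith [ht.1, ht.2]
  have h2 := eq_zero_time_of_hasDerivAt_zero hder ht
  have h3 := F.momentum_position (h.mem t ht)
  have h4 := F.momentum_position (h.mem 0 h0)
  simp only at h3 h4
  rw [h3, h4, hi, zero_div, div_eq_zero_iff] at h2
  exact h2.resolve_right (pow_ne_zero 2 (norm_ne_zero_iff.2 (h.mem t ht).1))

theorem norm_eq_one (h : IsEulerLagrangeOn F.sphereLagrangian (nonradial E) v (Ioo (-ε) ε))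
    (hi : ⟪v 0, deriv v 0⟫_ℝ = 0) (hv : ‖v 0‖ = 1) {t : ℝ} (ht : t ∈ Ioo (-ε) ε) : ‖v t‖ = 1 := by
  have hder : ∀ t ∈ Ioo (-ε) ε, HasDerivAt (fun τ => ‖v τ‖ ^ 2) 0 t := fun t ht => by
    have h1 := (h.hasDerivAt isOpen_Ioo ht).norm_sq
    rwa [h.inner_deriv_eq_zero hi ht, mul_zero] at h1
  have h2 := eq_zero_time_of_hasDerivAt_zero hder ht
  simp only [hv] at h2
  nlinarith [norm_nonneg (v t)]

/-- Any curve on the sphere is orthogonal to its velocity, so the extra term vanishes along every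
variation, and the ambient action is the Finsler energy. -/
theorem isGeodesicOn (h : IsEulerLagrangeOn F.sphereLagrangian (nonradial E) v (Ioo (-ε) ε))
    (hi : ⟪v 0, deriv v 0⟫_ℝ = 0) (hv : ‖v 0‖ = 1) :
    F.IsGeodesicOn (fun t => sphereProj (v t)) (Ioo (-ε) ε) := by
  have hvel : ∀ t ∈ Ioo (-ε) ε, velocity (d := d) (fun t => (sphereProj (v t) : sphere (0 : E) 1)) t =
      sphereLift d (v t, deriv v t) := fun t ht =>
    velocity_eq_sphereLift (h.hasDerivAt isOpen_Ioo ht) (h.mem t ht).1 EventuallyEq.rfl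
  refine ⟨?_, ?_, ?_⟩
  · exact contMDiffOn_sphereProj.comp h.contDiffOn.contMDiffOn fun t ht => (h.mem t ht).1
  · by_cases h0 : (0 : ℝ) ∈ Ioo (-ε) ε
    · refine ⟨F.toFun (sphereLift d (v 0, deriv v 0)),
        F.pos_off_zero _ _ (sphereDiff_ne_zero (h.mem 0 h0)), fun t ht => ?_⟩
      rw [hvel t ht]
      have hE := eq_zero_time_of_hasDerivAt_zero
        (fun t ht => h.hasDerivAt_energy isOpen_Ioo isOpen_nonradial F.contDiffOn_sphereLagrangian ht) ht
      have h1 := F.momentum_velocity (h.mem t ht)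
      have h2 := F.momentum_velocity (h.mem 0 h0)
      have h3 := F.sphereLagrangian_of_inner_eq_zero (z := (v t, deriv v t))
        (h.inner_deriv_eq_zero hi ht)
      have h4 := F.sphereLagrangian_of_inner_eq_zero (z := (v 0, deriv v 0)) hi
      simp only at h1 h2
      rw [h1, h2, h3, h4] at hE
      have h5 := F.toFun_nonneg (sphereLift d (v t, deriv v t))
      have h6 := F.toFun_nonneg (sphereLift d (v 0, deriv v 0))
      exact (sq_eq_sq₀ h5 h6).1 (by linarith)
    -- Here the interval is empty, so any positive constant serves as speed.
    · refine ⟨1, one_pos, fun t ht => absurd ?_ h0⟩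
      constructor <;> linarith [ht.1, ht.2]
  · intro a b hab hsub δ hδ g hg
    have hη : ContDiffOn ℝ ∞ (fun p : ℝ × ℝ => (g p.1 p.2 : E)) (Ioo (-δ) δ ×ˢ Ioo (-ε) ε) :=
      contMDiffOn_iff_contDiffOn.1 (contMDiff_coe_sphere.comp_contMDiffOn hg.smooth)
    have hpv : ∀ t ∈ Ioo (-ε) ε, (sphereProj (v t) : E) = v t := fun t ht => by
      rw [coe_sphereProj (h.mem t ht).1, h.norm_eq_one hi hv ht, inv_one, one_smul]
    have key := h.hasDerivAt_action isOpen_Ioo isOpen_nonradial F.contDiffOn_sphereLagrangian hab hδ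
      hsub hη (fun t ht => by rw [hg.base t ht, hpv t ht])
      (fun s hs => by rw [hg.left s hs, hpv a (hsub (left_mem_Icc.2 hab.le))])
      (fun s hs => by rw [hg.right s hs, hpv b (hsub (right_mem_Icc.2 hab.le))])
    refine key.congr_of_eventuallyEq ?_
    filter_upwards [Ioo_mem_nhds (neg_lt_zero.2 hδ) hδ] with s hs
    refine intervalIntegral.integral_congr fun t ht => ?_
    rw [uIcc_of_le hab.le] at ht
    have hmem : (s, t) ∈ Ioo (-δ) δ ×ˢ Ioo (-ε) ε := ⟨hs, hsub ht⟩
    have hd : HasDerivAt (fun τ => (g s τ : E))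
        (fderiv ℝ (fun p : ℝ × ℝ => (g p.1 p.2 : E)) (s, t) (0, 1)) t :=
      ((hη.contDiffAt ((isOpen_Ioo.prod isOpen_Ioo).mem_nhds hmem)).differentiableAt
        (by simp)).hasFDerivAt.comp_hasDerivAt t ((hasDerivAt_const t s).prodMk (hasDerivAt_id t))
    have hinner : ⟪(g s t : E), fderiv ℝ (fun p : ℝ × ℝ => (g p.1 p.2 : E)) (s, t) (0, 1)⟫_ℝ = 0 := by
      have h1 := hd.norm_sq
      simp only [norm_eq_of_mem_sphere, one_pow] at h1
      have h2 := h1.unique (hasDerivAt_const t 1)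
      linarith
    change F.toFun (velocity (g s) t) ^ 2 / 2 = _
    rw [F.sphereLagrangian_of_inner_eq_zero hinner, velocity_eq_sphereLift hd
      (ne_zero_of_mem_unit_sphere _) (Eventually.of_forall fun τ => (sphereProj_coe _).symm)]

end IsEulerLagrangeOn

/-- If a solution of the Euler-Lagrange equation is moved by symmetries `T t` of the Lagrangian, then
the Lagrangian is infinitesimally invariant at its initial velocity under any linear map that
commutes with all of them. -/
theorem force_add_momentum_eq_zero_of_orbit {V : Type*} [NormedAddCommGroup V] [NormedSpace ℝ V]
    {L : V × V → ℝ} {Ω : Set (V × V)} (hΩ : IsOpen Ω) (hL : ContDiffOn ℝ ∞ L Ω) {v : ℝ → V} {ε : ℝ}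
    (hε : 0 < ε) (h : IsEulerLagrangeOn L Ω v (Ioo (-ε) ε)) {T : ℝ → V →L[ℝ] V}
    (hT : ∀ t, ∀ z ∈ Ω, L (T t z.1, T t z.2) = L z) {p w : V} (hpw : (p, w) ∈ Ω)
    (hv : ∀ t ∈ Ioo (-ε) ε, v t = T t p) (hw : ∀ t ∈ Ioo (-ε) ε, deriv v t = T t w)
    {R : V →L[ℝ] V} (hR : ∀ t u, R (T t u) = T t (R u)) :
    force L (v 0, deriv v 0) (R (v 0)) + momentum L (v 0, deriv v 0) (R (deriv v 0)) = 0 := by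
  have h0 : (0 : ℝ) ∈ Ioo (-ε) ε := by simp [hε]
  have h1 := h.hasDerivAt_momentum_apply h0
    (R.hasFDerivAt.comp_hasDerivAt 0 (h.hasDerivAt isOpen_Ioo h0))
  -- Differentiating `L ∘ (T t × T t) = L` shows that `T t` pulls the momentum at the moved point
  -- back to the one at `(p, w)`; since `R` commutes with `T t`, the pairing does not depend on
  -- time.
  have h2 : (fun τ => momentum L (v τ, deriv v τ) ((R ∘ v) τ)) =ᶠ[𝓝 0]
      fun _ => momentum L (p, w) (R p) := by
    filter_upwards [isOpen_Ioo.mem_nhds h0] with t ht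
    have h3 := hasFDerivAt_lagrangian hΩ hL (h.mem t ht)
    rw [hv t ht, hw t ht] at h3
    have h4 : HasFDerivAt L _ (p, w) :=
      (h3.comp (p, w) ((T t).prodMap (T t)).hasFDerivAt).congr_of_eventuallyEq
        (by filter_upwards [hΩ.mem_nhds hpw] with z hz using (hT t z hz).symm)
    simp only [Function.comp_apply, hv t ht, hw t ht, hR, momentum, h4.fderiv]
    simp
  exact h1.unique ((hasDerivAt_const _ _).congr_of_eventuallyEq h2)

end SphereGeodesics

/-! ### Linear symmetries of the sphere -/

section LinearSymmetry

open Set Filter Topology Module Metric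
open scoped InnerProductSpace

variable {E : Type*} [NormedAddCommGroup E] [InnerProductSpace ℝ E]
  {g : sphere (0 : E) 1 → sphere (0 : E) 1} {T : E →L[ℝ] E}

theorem norm_map_of_coe_eq (hg : ∀ x, (g x : E) = T x) (v : E) : ‖T v‖ = ‖v‖ := by
  by_cases hv : v = 0
  · simp [hv]
  · have h1 : ‖T (‖v‖⁻¹ • v)‖ = 1 := by
      have h := hg ⟨‖v‖⁻¹ • v, by simp [norm_smul, hv]⟩
      rw [← h, norm_eq_of_mem_sphere]
    have hn := norm_ne_zero_iff.2 hv
    rw [map_smul, norm_smul, norm_inv, norm_norm, inv_mul_eq_one₀ hn] at h1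
    exact h1.symm

theorem inner_map_of_coe_eq (hg : ∀ x, (g x : E) = T x) (v w : E) : ⟪T v, T w⟫_ℝ = ⟪v, w⟫_ℝ :=
  LinearIsometry.inner_map_map ⟨T.toLinearMap, norm_map_of_coe_eq hg⟩ v w

variable [Nonempty (sphere (0 : E) 1)]

theorem sphereProj_map (hg : ∀ x, (g x : E) = T x) {v : E} (hv : v ≠ 0) :
    sphereProj (T v) = g (sphereProj v) := by
  have hTv : T v ≠ 0 := by rwa [← norm_ne_zero_iff, norm_map_of_coe_eq hg, norm_ne_zero_iff]
  refine Subtype.ext ?_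
  rw [coe_sphereProj hTv, hg, coe_sphereProj hv, map_smul, norm_map_of_coe_eq hg]

variable {d : ℕ} [Fact (finrank ℝ E = d + 1)]

theorem mdifferentiableAt_of_coe_eq (hg : ∀ x, (g x : E) = T x) (x : sphere (0 : E) 1) :
    MDifferentiableAt (𝓡 d) (𝓡 d) g x := by
  have h : g = sphereProj ∘ (T ∘ ((↑) : sphere (0 : E) 1 → E)) := funext fun x => by
    simp [← hg]
  rw [h]
  refine MDifferentiableAt.comp x (mdifferentiableAt_sphereProj ?_)
    (T.differentiableAt.mdifferentiableAt.comp x (mdifferentiableAt_coe_sphere x))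
  change T x ≠ 0
  rw [← hg]
  exact ne_zero_of_mem_unit_sphere _

theorem sphereLift_map_eq_tangentMap (hg : ∀ x, (g x : E) = T x) {v : E} (hv : v ≠ 0) (w : E) :
    sphereLift d (T v, T w) = tangentMap (𝓡 d) (𝓡 d) g (sphereLift d (v, w)) := by
  have hTv : T v ≠ 0 := by rwa [← norm_ne_zero_iff, norm_map_of_coe_eq hg, norm_ne_zero_iff]
  refine sphereLift_map (mdifferentiableAt_of_coe_eq hg _) hv hTv ?_
  filter_upwards [isOpen_ne.mem_nhds hv] with u hu using sphereProj_map hg hu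

namespace FinslerMetric

variable (F : FinslerMetric d (sphere (0 : E) 1))

theorem sphereLagrangian_map (hg : ∀ x, (g x : E) = T x)
    (hF : ∀ p, F.toFun (tangentMap (𝓡 d) (𝓡 d) g p) = F.toFun p) {z : E × E} (hz : z.1 ≠ 0) :
    F.sphereLagrangian (T z.1, T z.2) = F.sphereLagrangian z := by
  simp only [sphereLagrangian, sphereLift_map_eq_tangentMap hg hz, hF, inner_map_of_coe_eq hg,
    norm_map_of_coe_eq hg]

/-- Converse of `sphereLagrangian_map`: orthogonal pairs at unit vectors represent all tangent
vectors, and on them the Lagrangian is `F² / 2`. -/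
theorem toFun_tangentMap (hg : ∀ x, (g x : E) = T x)
    (hL : ∀ (x : sphere (0 : E) 1) (w : E), ⟪(x : E), w⟫_ℝ = 0 →
      F.sphereLagrangian (T x, T w) = F.sphereLagrangian ((x : E), w))
    (p : TangentBundle (𝓡 d) (sphere (0 : E) 1)) :
    F.toFun (tangentMap (𝓡 d) (𝓡 d) g p) = F.toFun p := by
  obtain ⟨x, y⟩ := p
  have hi := inner_coe_mfderiv_coe x y
  have h1 := sphereLift_coe x y
  have h2 := sphereLift_map_eq_tangentMap (d := d) hg (ne_zero_of_mem_unit_sphere x)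
    (mfderiv (𝓡 d) 𝓘(ℝ, E) ((↑) : sphere (0 : E) 1 → E) x y)
  have h3 := hL x _ hi
  rw [F.sphereLagrangian_of_inner_eq_zero (z := (_, _)) hi, F.sphereLagrangian_of_inner_eq_zero
    (z := (_, _)) ((inner_map_of_coe_eq hg _ _).trans hi), h2, h1] at h3
  exact (sq_eq_sq₀ (F.toFun_nonneg _) (F.toFun_nonneg _)).1 (by linarith)

theorem sphereLagrangian_zero_right (v : E) : F.sphereLagrangian (v, 0) = 0 := by
  have h : F.toFun (sphereLift d (v, 0)) = 0 := by
    have h := F.homogeneous (sphereProj v) 0 0 le_rfl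
    rw [zero_smul, zero_mul] at h
    rwa [sphereLift, map_zero]
  simp [sphereLagrangian, h]

end FinslerMetric
end LinearSymmetry

/-! ### The symplectic group and right multiplication by quaternions -/

section Symplectic

open Set Filter Topology Module Metric
open scoped InnerProductSpace

variable {n : ℕ}

/-- Left multiplication by a quaternionic matrix. -/
def mulVecCLM (A : Matrix (Fin n) (Fin n) ℍ[ℝ]) : HSpace n →L[ℝ] HSpace n :=
  LinearMap.toContinuousLinearMap
    { toFun := fun x => WithLp.toLp 2 (A.mulVec x.ofLp)
      map_add' := fun x y => by simp [Matrix.mulVec_add]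
      map_smul' := fun r x => by simp [Matrix.mulVec_smul] }

/-- Right multiplication by a quaternion. -/
def rightMulCLM (q : ℍ[ℝ]) : HSpace n →L[ℝ] HSpace n :=
  LinearMap.toContinuousLinearMap
    { toFun := fun x => WithLp.toLp 2 (fun i => x.ofLp i * q)
      map_add' := fun x y => by ext1; simp [add_mul]
      map_smul' := fun r x => by ext1; simp }

theorem mulVecCLM_apply (A : Matrix (Fin n) (Fin n) ℍ[ℝ]) (x : HSpace n) :
    mulVecCLM A x = WithLp.toLp 2 (A.mulVec x.ofLp) := rfl

theorem rightMulCLM_apply (q : ℍ[ℝ]) (x : HSpace n) :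
    rightMulCLM q x = WithLp.toLp 2 (fun i => x.ofLp i * q) := rfl

theorem rightMulCLM_mulVecCLM (q : ℍ[ℝ]) (A : Matrix (Fin n) (Fin n) ℍ[ℝ]) (x : HSpace n) :
    rightMulCLM q (mulVecCLM A x) = mulVecCLM A (rightMulCLM q x) := by
  simp only [rightMulCLM_apply, mulVecCLM_apply]
  congr 1
  funext i
  simp only [Matrix.mulVec, dotProduct, Finset.sum_mul, mul_assoc]

theorem mulVecCLM_mul (A B : Matrix (Fin n) (Fin n) ℍ[ℝ]) (x : HSpace n) :
    mulVecCLM (A * B) x = mulVecCLM A (mulVecCLM B x) := by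
  simp [mulVecCLM_apply, Matrix.mulVec_mulVec]

theorem mulVecCLM_one (x : HSpace n) : mulVecCLM 1 x = x := by
  simp [mulVecCLM_apply]

theorem rightMulCLM_mul (p q : ℍ[ℝ]) (x : HSpace n) :
    rightMulCLM (p * q) x = rightMulCLM q (rightMulCLM p x) := by
  simp [rightMulCLM_apply, mul_assoc]

theorem coe_smul_sp (A : Sp n) (x : HSphere n) : ((A • x : HSphere n) : HSpace n) =
    mulVecCLM A.1 x := rfl

theorem coe_smul_prod (g : Sp n × UnitQuaternion) (x : HSphere n) :
    ((g • x : HSphere n) : HSpace n) =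
      ((rightMulCLM (star (g.2 : ℍ[ℝ]))).comp (mulVecCLM g.1.1)) x := rfl

theorem norm_rightMulCLM {q : ℍ[ℝ]} (hq : ‖q‖ = 1) (x : HSpace n) : ‖rightMulCLM q x‖ = ‖x‖ := by
  rw [PiLp.norm_eq_of_L2, PiLp.norm_eq_of_L2]
  simp [rightMulCLM_apply, hq]

theorem inner_rightMulCLM {q : ℍ[ℝ]} (hq : ‖q‖ = 1) (x y : HSpace n) :
    ⟪rightMulCLM q x, rightMulCLM q y⟫_ℝ = ⟪x, y⟫_ℝ :=
  LinearIsometry.inner_map_map ⟨(rightMulCLM q).toLinearMap, norm_rightMulCLM hq⟩ x y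

theorem oneParam_zero (X : LieSp n) : (oneParam X 0).1 = 1 := by
  simp [oneParam]

theorem oneParam_add (X : LieSp n) (s t : ℝ) :
    (oneParam X (s + t)).1 = (oneParam X s).1 * (oneParam X t).1 := by
  let _ : NormedAlgebra ℚ ℍ[ℝ] := NormedAlgebra.restrictScalars ℚ ℝ _
  simp only [oneParam]
  rw [add_smul]
  exact Matrix.exp_add_of_commute _ _ (((Commute.refl X.1).smul_left s).smul_right t)

theorem imaginaryUnit_mul_self {θ : ℍ[ℝ]} (hre : θ.re = 0) (hθ : ‖θ‖ = 1) : θ * θ = -1 := by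
  rw [← sq, Quaternion.sq_eq_neg_normSq.2 hre, Quaternion.normSq_eq_norm_mul_self, hθ]
  simp

theorem norm_cos_add_sin {θ : ℍ[ℝ]} (hre : θ.re = 0) (hθ : ‖θ‖ = 1) (s : ℝ) :
    ‖(Real.cos s : ℍ[ℝ]) + Real.sin s • θ‖ = 1 := by
  have h1 := Quaternion.normSq_eq_norm_mul_self θ
  have h2 := Quaternion.normSq_eq_norm_mul_self ((Real.cos s : ℍ[ℝ]) + Real.sin s • θ)
  rw [hθ, Quaternion.normSq_def', hre] at h1
  rw [Quaternion.normSq_def'] at h2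
  simp [hre] at h2
  have h3 : ‖(Real.cos s : ℍ[ℝ]) + Real.sin s • θ‖ ^ 2 = 1 ^ 2 := by
    linear_combination -h2 + Real.sin s ^ 2 * h1 + Real.sin_sq_add_cos_sq s
  exact (sq_eq_sq₀ (norm_nonneg _) zero_le_one).1 h3

/-- A unit quaternion is `cos s + θ sin s` for an imaginary unit `θ`. -/
theorem exists_eq_cos_add_sin {q : ℍ[ℝ]} (hq : ‖q‖ = 1) :
    ∃ (θ : ℍ[ℝ]) (s : ℝ), θ.re = 0 ∧ ‖θ‖ = 1 ∧ q = (Real.cos s : ℍ[ℝ]) + Real.sin s • θ := by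
  have hsq : q.re ^ 2 + ‖q.im‖ ^ 2 = 1 := by
    have h1 := Quaternion.normSq_eq_norm_mul_self q
    have h2 := Quaternion.normSq_eq_norm_mul_self q.im
    rw [hq, Quaternion.normSq_def'] at h1
    rw [Quaternion.normSq_def'] at h2
    simp at h2
    linarith
  obtain ⟨θ, hre, hθ, him⟩ : ∃ θ : ℍ[ℝ], θ.re = 0 ∧ ‖θ‖ = 1 ∧ q.im = ‖q.im‖ • θ := by
    by_cases h : q.im = 0
    -- For real `q` any imaginary unit would do.
    · let i : ℍ[ℝ] := ⟨0, 1, 0, 0⟩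
      have h1 := Quaternion.normSq_eq_norm_mul_self i
      rw [Quaternion.normSq_def'] at h1
      refine ⟨i, rfl, ?_, by rw [h, norm_zero, zero_smul]⟩
      simp [i] at h1
      nlinarith [norm_nonneg i]
    · have hn := norm_ne_zero_iff.2 h
      exact ⟨‖q.im‖⁻¹ • q.im, by simp, by simp [norm_smul, hn], (smul_inv_smul₀ hn _).symm⟩
  -- `arccos` takes values where `sin` is nonnegative, so the sine is `‖q.im‖` without a sign.
  refine ⟨θ, Real.arccos q.re, hre, hθ, ?_⟩
  have h1 : Real.sqrt (1 - q.re ^ 2) = ‖q.im‖ := by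
    have h2 : 1 - q.re ^ 2 = ‖q.im‖ ^ 2 := by linarith
    rw [h2, Real.sqrt_sq (norm_nonneg _)]
  rw [Real.cos_arccos (by nlinarith [sq_nonneg ‖q.im‖]) (by nlinarith [sq_nonneg ‖q.im‖]),
    Real.sin_arccos, h1, ← him, Quaternion.re_add_im]

theorem rightMulCLM_cos_add_sin (θ : ℍ[ℝ]) (s : ℝ) (x : HSpace n) :
    rightMulCLM ((Real.cos s : ℍ[ℝ]) + Real.sin s • θ) x =
      Real.cos s • x + Real.sin s • rightMulCLM θ x := by
  ext1 i
  simp only [rightMulCLM_apply, PiLp.add_apply, PiLp.smul_apply, mul_add, mul_smul_comm,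
    Quaternion.mul_coe_eq_smul]

/-- Since `θ² = -1`, the curve `q(s) = cos s + θ sin s` satisfies `q' = qθ`. -/
theorem hasDerivAt_rightMulCLM_cos_add_sin {θ : ℍ[ℝ]} (hre : θ.re = 0) (hθ : ‖θ‖ = 1)
    (x : HSpace n) (s : ℝ) :
    HasDerivAt (fun s : ℝ => rightMulCLM ((Real.cos s : ℍ[ℝ]) + Real.sin s • θ) x)
      (rightMulCLM θ (rightMulCLM ((Real.cos s : ℍ[ℝ]) + Real.sin s • θ) x)) s := by
  have hneg : rightMulCLM θ (rightMulCLM θ x) = -x := by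
    rw [← rightMulCLM_mul, imaginaryUnit_mul_self hre hθ]
    ext1 i
    simp [rightMulCLM_apply]
  simp only [rightMulCLM_cos_add_sin, map_add, map_smul, hneg]
  have h := ((Real.hasDerivAt_cos s).smul_const x).add
    ((Real.hasDerivAt_sin s).smul_const (rightMulCLM θ x))
  refine h.congr_deriv ?_
  rw [neg_smul, smul_neg, add_comm]

end Symplectic

/-! ### Right invariance of geodesic orbit metrics -/

section GeodesicOrbitMetrics

open Set Filter Topology Module Metric
open scoped InnerProductSpace

variable {n : ℕ} [NeZero n] {F : FinslerMetric (4 * n - 1) (HSphere n)}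

/-- The Lagrangian of an `Sp(n)`-geodesic orbit metric is infinitesimally invariant under right
multiplication by quaternions. -/
theorem IsSpGeodesicOrbit.force_add_momentum_rightMul [Nonempty (HSphere n)]
    (hgo : IsSpGeodesicOrbit F) (hinv : F.IsInvariant (Sp n)) (θ : ℍ[ℝ]) {x w : HSpace n}
    (hx : ‖x‖ = 1) (hw : w ≠ 0) (hxw : ⟪x, w⟫_ℝ = 0) :
    force F.sphereLagrangian (x, w) (rightMulCLM θ x) +
      momentum F.sphereLagrangian (x, w) (rightMulCLM θ w) = 0 := by
  have hx0 : x ≠ 0 := norm_ne_zero_iff.1 (by rw [hx]; exact one_ne_zero)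
  have hmem := mem_nonradial_of_inner_eq_zero hx0 hw hxw
  obtain ⟨ε, hε, v, hv0, hv'0, hv⟩ := exists_isEulerLagrangeOn isOpen_nonradial
    F.contDiffOn_sphereLagrangian (fun z hz u hu => F.sphereLagrangian_hessian_pos hz hu) hmem
  simp only at hv0 hv'0
  have hi : ⟪v 0, deriv v 0⟫_ℝ = 0 := by rw [hv0, hv'0, hxw]
  have hn : ‖v 0‖ = 1 := by rw [hv0, hx]
  have h0 : (0 : ℝ) ∈ Ioo (-ε) ε := by simp [hε]
  obtain ⟨X, p, hX⟩ := hgo _ _ isOpen_Ioo ordConnected_Ioo (hv.isGeodesicOn hi hn)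
  let T : ℝ → HSpace n →L[ℝ] HSpace n := fun t => mulVecCLM (oneParam X t).1
  have hTp : ∀ t ∈ Ioo (-ε) ε, v t = T t p := fun t ht => by
    have h1 := congrArg (Subtype.val : HSphere n → HSpace n) (hX t ht)
    rw [coe_sphereProj (hv.mem t ht).1, hv.norm_eq_one hi hn ht, inv_one, one_smul] at h1
    exact h1
  have hp : (p : HSpace n) = x := by
    have h1 := hTp 0 h0
    simp only [T, oneParam_zero, mulVecCLM_one] at h1
    rw [← h1, hv0]
  rw [hp] at hTp
  -- The one-parameter group law gives `v (t + s) = T t (v s)`; the velocities follow by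
  -- differentiating at `s = 0`.
  have hTw : ∀ t ∈ Ioo (-ε) ε, deriv v t = T t w := fun t ht => by
    have h1 : HasDerivAt (fun s => v (t + s)) (deriv v t) 0 :=
      HasDerivAt.comp_const_add t 0 (by rw [add_zero]; exact hv.hasDerivAt isOpen_Ioo ht)
    have h2 : HasDerivAt (fun s => T t (v s)) (T t w) 0 :=
      (T t).hasFDerivAt.comp_hasDerivAt 0 (hv'0 ▸ hv.hasDerivAt isOpen_Ioo h0)
    have h3 : (fun s => v (t + s)) =ᶠ[𝓝 0] fun s => T t (v s) := by
      have hc : ContinuousAt (fun s : ℝ => t + s) 0 := by fun_prop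
      filter_upwards [isOpen_Ioo.mem_nhds h0,
        hc.eventually_mem (isOpen_Ioo.mem_nhds (by rwa [add_zero]))] with s hs hts
      rw [hTp _ hts, hTp _ hs]
      simp only [T, oneParam_add, mulVecCLM_mul]
    exact h1.unique (h2.congr_of_eventuallyEq h3)
  have key := force_add_momentum_eq_zero_of_orbit isOpen_nonradial F.contDiffOn_sphereLagrangian hε
    hv (T := T) (fun t z hz => F.sphereLagrangian_map (coe_smul_sp (oneParam X t))
      (fun y => hinv _ y.1 y.2) hz.1) hmem hTp hTw
    (R := rightMulCLM θ) (fun t u => rightMulCLM_mulVecCLM θ _ u)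
  rwa [hv0, hv'0] at key

theorem IsSpGeodesicOrbit.sphereLagrangian_rightMul [Nonempty (HSphere n)]
    (hgo : IsSpGeodesicOrbit F) (hinv : F.IsInvariant (Sp n)) {q : ℍ[ℝ]} (hq : ‖q‖ = 1)
    {x w : HSpace n} (hx : ‖x‖ = 1) (hxw : ⟪x, w⟫_ℝ = 0) :
    F.sphereLagrangian (rightMulCLM q x, rightMulCLM q w) = F.sphereLagrangian (x, w) := by
  -- The Lagrangian is known to be smooth only on `nonradial`, which excludes zero velocity.
  by_cases hw : w = 0
  · rw [hw, map_zero, F.sphereLagrangian_zero_right, F.sphereLagrangian_zero_right]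
  obtain ⟨θ, s, hre, hθ, rfl⟩ := exists_eq_cos_add_sin hq
  let q : ℝ → ℍ[ℝ] := fun s => (Real.cos s : ℍ[ℝ]) + Real.sin s • θ
  have hnq : ∀ s, ‖q s‖ = 1 := norm_cos_add_sin hre hθ
  -- The rotated pair stays orthogonal with unit position, so the infinitesimal invariance applies
  -- at every `s`, not just at `0`.
  have hder : ∀ s, HasDerivAt
      (fun s => F.sphereLagrangian (rightMulCLM (q s) x, rightMulCLM (q s) w)) 0 s := fun s => by
    have hxs : ‖rightMulCLM (q s) x‖ = 1 := by rw [norm_rightMulCLM (hnq s), hx]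
    have hws : rightMulCLM (q s) w ≠ 0 := by
      rwa [← norm_ne_zero_iff, norm_rightMulCLM (hnq s), norm_ne_zero_iff]
    have hi : ⟪rightMulCLM (q s) x, rightMulCLM (q s) w⟫_ℝ = 0 := by
      rw [inner_rightMulCLM (hnq s), hxw]
    have hxs0 : rightMulCLM (q s) x ≠ 0 := norm_ne_zero_iff.1 (by rw [hxs]; exact one_ne_zero)
    have h1 := hasDerivAt_lagrangian isOpen_nonradial F.contDiffOn_sphereLagrangian
      (x := fun s => rightMulCLM (q s) x) (y := fun s => rightMulCLM (q s) w)
      (mem_nonradial_of_inner_eq_zero hxs0 hws hi)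
      (hasDerivAt_rightMulCLM_cos_add_sin hre hθ x s)
      (hasDerivAt_rightMulCLM_cos_add_sin hre hθ w s)
    exact h1.congr_deriv (hgo.force_add_momentum_rightMul hinv θ hxs hws hi)
  have h0 : ∀ u : HSpace n, rightMulCLM (q 0) u = u := fun u => by
    simp [q, rightMulCLM_apply]
  have h1 := is_const_of_deriv_eq_zero (fun s => (hder s).differentiableAt)
    (fun s => (hder s).deriv) s 0
  simp only [h0] at h1
  exact h1

end GeodesicOrbitMetrics

end GeodesicOrbit

end

theorem mainTheorem4 (n : ℕ) [NeZero n]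
    (F : GeodesicOrbit.FinslerMetric (4 * n - 1) (GeodesicOrbit.HSphere n))
    (hinv : F.IsInvariant (GeodesicOrbit.Sp n))
    (hgo : GeodesicOrbit.IsSpGeodesicOrbit F) :
    F.IsInvariant (GeodesicOrbit.Sp n × GeodesicOrbit.UnitQuaternion) := by
  intro g x y
  have : Nonempty (GeodesicOrbit.HSphere n) := ⟨x⟩
  refine F.toFun_tangentMap (GeodesicOrbit.coe_smul_prod g) (fun z w hzw => ?_) ⟨x, y⟩
  have hsp := GeodesicOrbit.coe_smul_sp g.1
  -- The action of `(A, q)` is left multiplication by `A` followed by right multiplication by `star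
  -- q`; the second factor is removed first, at the already moved pair.
  refine (hgo.sphereLagrangian_rightMul hinv (GeodesicOrbit.norm_unitQuaternion g.2)
    ((GeodesicOrbit.norm_map_of_coe_eq hsp _).trans (by simp))
    ((GeodesicOrbit.inner_map_of_coe_eq hsp _ _).trans hzw)).trans ?_
  exact F.sphereLagrangian_map hsp (fun p => hinv g.1 p.1 p.2)
    (z := (z.1, w)) (ne_zero_of_mem_unit_sphere z)
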